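/- Let $R$ be a commutative ring and let $C$ be a semidualizing $R$-module, that is: $C$ has a (possibly unbounded) resolution by free $R$-modules of finite rank, the homothety map $R\to\operatorname{Hom}_R(C,C)$ is an isomorphism, and $\operatorname{Ext}^i_R(C,C)=0$ for all $i\ge 1$. Let $\mathcal I_C$ be the class of $R$-modules isomorphic to $\operatorname{Hom}_R(C,I)$ with $I$ an injective $R$-module. A complex $S$ of modules in $\mathcal I_C$ is totally $\mathcal I_C$-acyclic if it is exact and $\operatorname{Hom}_R(X,S)$ and $\operatorname{Hom}_R(S,X)$ are exact for every $X\in\mathcal I_C$; let $\mathcal G(\mathcal I_C)$ be the class of modules isomorphic to $\operatorname{Coker}(S^{-1}\to S^0)$ for such an $S$. For a class $\mathcal Y$ of modules, a $\mathcal Y$-coresolution of $N$ is an exact sequence $0\to N\to Y^0\to Y^1\to\cdots$ with all $Y^n\in\mathcal Y$; it is proper if it stays exact under $\operatorname{Hom}_R(-,X)$ for every $X\in\mathcal Y$; and $\mathcal Y\text{-}\mathrm{id}_R(N)$ is the infimum of $\sup\{n\ge 0: Y^n\ne 0\}$ over all $\mathcal Y$-coresolutions of $N$. A Tate $\mathcal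 I_C$-coresolution of $N$ is a diagram $N\to Y\xrightarrow{\beta}S$ in which $N\to Y$ is a proper $\mathcal I_C$-coresolution, $S$ is totally $\mathcal I_C$-acyclic, and $\beta$ is a morphism of complexes with $\beta^n$ an isomorphism for all $n\gg 0$. If $N$ admits one, put $\widehat{\operatorname{Ext}}^n_{\mathcal I_C}(L,N)=H^n(\operatorname{Hom}_R(L,S))$ for every $R$-module $L$ and every $n\in\mathbb Z$. Let $M$ be an $R$-module with $\mathcal G(\mathcal I_C)\text{-}\mathrm{id}_R(M)<\infty$. Then $M$ admits a Tate $\mathcal I_C$-coresolution, and the following conditions are equivalent: (i) $\mathcal I_C\text{-}\mathrm{id}_R(M)<\infty$; (ii) $\widehat{\operatorname{Ext}}^n_{\mathcal I_C}(M,-)=0$ on the modules that admit a Tate $\mathcal I_C$-coresolution, for each (equivalently, for some) $n\in\mathbb Z$; (iii) $\widehat{\operatorname{Ext}}^n_{\mathcal I_C}(-,M)=0$ on all $R$-modules, for each (equivalently, for some) $n\in\mathbb Z$; (iv) $\widehat{\operatorname{Ext}}^0_{\mathcal I_C}(M,M)=0$. -/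

import Mathlib

open CategoryTheory CategoryTheory.Limits

universe v u

namespace RelativeTate

section Abelian

variable {A : Type u} [Category.{v} A] [Abelian A]

/-- The complex `Hom(X, K)`. -/
noncomputable def homFrom {ι : Type*} {c : ComplexShape ι} (X : A) (K : HomologicalComplex A c) :
    HomologicalComplex AddCommGrpCat.{v} c :=
  ((preadditiveCoyoneda.obj (Opposite.op X)).mapHomologicalComplex c).obj K

/-- The complex `Hom(K, X)`. -/
noncomputable def homTo {ι : Type*} {c : ComplexShape ι} (K : HomologicalComplex A c) (X : A) :
    HomologicalComplex AddCommGrpCat.{v} c.symm :=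
  ((preadditiveYoneda.obj X).mapHomologicalComplex c.symm).obj K.op

/-- `K` is `Hom(𝒱, -)`-exact. -/
def IsHomFromExact {ι : Type*} {c : ComplexShape ι} (V : ObjectProperty A)
    (K : HomologicalComplex A c) : Prop :=
  ∀ X : A, V X → (homFrom X K).Acyclic

/-- `K` is `Hom(-, 𝒱)`-exact. -/
def IsHomToExact {ι : Type*} {c : ComplexShape ι} (V : ObjectProperty A)
    (K : HomologicalComplex A c) : Prop :=
  ∀ X : A, V X → (homTo K X).Acyclic

/-- A totally `𝒱`-acyclic complex: an exact complex of objects of `𝒱` that is both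
`Hom(𝒱, -)`-exact and `Hom(-, 𝒱)`-exact. All complexes are written cohomologically: the term that
is in degree `n` here is the one in homological degree `-n`. -/
structure IsTotallyAcyclic (V : ObjectProperty A) (S : CochainComplex A ℤ) : Prop where
  mem : ∀ n, V (S.X n)
  exact : S.Acyclic
  homFrom_exact : IsHomFromExact V S
  homTo_exact : IsHomToExact V S

/-- The class `𝒢(𝒱)` of the objects isomorphic to `Coker (S⁻¹ ⟶ S⁰)` for some totally
`𝒱`-acyclic complex `S`. -/
def gorenstein (V : ObjectProperty A) : ObjectProperty A := fun M =>
  ∃ S : CochainComplex A ℤ, IsTotallyAcyclic V S ∧ Nonempty (M ≅ cokernel (S.d (-1) 0))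

/-- A `𝒱`-coresolution `0 ⟶ N ⟶ Y⁰ ⟶ Y¹ ⟶ ⋯` of `N`. -/
structure Coresolution (V : ObjectProperty A) (N : A) where
  /-- the complex `Y` -/
  complex : CochainComplex A ℕ
  /-- the coaugmentation `N ⟶ Y⁰` -/
  ι : N ⟶ complex.X 0
  ι_d : ι ≫ complex.d 0 1 = 0
  mem : ∀ n, V (complex.X n)
  exact : (complex.augment ι ι_d).Acyclic

/-- The augmented coresolution `0 ⟶ N ⟶ Y⁰ ⟶ Y¹ ⟶ ⋯`, with `N` placed in degree `0`. -/
noncomputable def Coresolution.augmented {V : ObjectProperty A} {N : A} (Y : Coresolution V N) :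
    CochainComplex A ℕ :=
  Y.complex.augment Y.ι Y.ι_d

/-- A `𝒱`-coresolution is proper if the augmented coresolution is `Hom(-, 𝒱)`-exact. -/
def Coresolution.IsProper {V : ObjectProperty A} {N : A} (Y : Coresolution V N) : Prop :=
  IsHomToExact V Y.augmented

/-- The length `sup {n | Yⁿ ≠ 0}` of a coresolution. -/
noncomputable def Coresolution.length {V : ObjectProperty A} {N : A} (Y : Coresolution V N) : ℕ∞ :=
  ⨆ (n : ℕ) (_ : ¬ IsZero (Y.complex.X n)), (n : ℕ∞)

/-- The `𝒱`-injective dimension of `N`: the infimum of the lengths of its `𝒱`-coresolutions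
(so it is `⊤` if there is none). -/
noncomputable def injDim (V : ObjectProperty A) (N : A) : ℕ∞ :=
  ⨅ Y : Coresolution V N, Y.length

/-- A Tate `𝒱`-coresolution `N ⟶ Y ⟶ S` of `N`: a proper `𝒱`-coresolution `Y` of `N` (regarded as
a complex indexed by `ℤ` that vanishes in negative degrees), a totally `𝒱`-acyclic complex `S`, and
a morphism of complexes `β : Y ⟶ S` that is an isomorphism in all large cohomological degrees. -/
structure TateCoresolution (V : ObjectProperty A) (N : A) where
  Y : Coresolution V N
  proper : Y.IsProper
  S : CochainComplex A ℤ
  totallyAcyclic : IsTotallyAcyclic V S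
  β : Y.complex.extend ComplexShape.embeddingUpNat ⟶ S
  isIso_β : ∃ n₀ : ℤ, ∀ n, n₀ ≤ n → IsIso (β.f n)

/-- `N` admits a Tate `𝒱`-coresolution. -/
def HasTateCoresolution (V : ObjectProperty A) (N : A) : Prop :=
  Nonempty (TateCoresolution V N)

/-- The Tate cohomology group of `(M, N)` in degree `n`, the cohomology `Hⁿ(Hom(M, S))` for a
Tate `𝒱`-coresolution `N ⟶ Y ⟶ S`. It is defined for every `M` and for every `N` that admits a
Tate `𝒱`-coresolution. -/
noncomputable def tateExt (V : ObjectProperty A) (n : ℤ) (M N : A)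
    (hN : HasTateCoresolution V N) : AddCommGrpCat.{v} :=
  (homFrom M (Classical.choice hN).S).homology n

end Abelian

section Modules

variable {R : Type u} [CommRing R]

/-- Semidualizing modules. -/
structure IsSemidualizing (C : ModuleCat.{u} R) : Prop where
  /-- `C` has a (possibly unbounded) resolution by free modules of finite rank. -/
  exists_resolution : ∃ (P : ChainComplex (ModuleCat.{u} R) ℕ) (π : P.X 0 ⟶ C)
    (w : P.d 1 0 ≫ π = 0), (∀ n, Module.Free R (P.X n) ∧ Module.Finite R (P.X n)) ∧
      (P.augment π w).Acyclic
  /-- The homothety map `R → Hom(C, C)` is an isomorphism. -/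
  homothety_bijective : Function.Bijective (LinearMap.lsmul R C)
  ext_eq_zero : ∀ n : ℕ, 1 ≤ n → Subsingleton (Abelian.Ext C C n)

/-- The class `ℐ_C(R)` of the `C`-injective modules, those isomorphic to `Hom(C, I)` for some
injective module `I`. -/
def cInjective (C : ModuleCat.{u} R) : ObjectProperty (ModuleCat.{u} R) := fun N =>
  ∃ I : ModuleCat.{u} R, Injective I ∧ Nonempty (N ≅ ModuleCat.of R (C →ₗ[R] I))

end Modules

end RelativeTate


/-
The argument works for every class `V` of objects of an abelian category that is closed under
finite sums and direct summands and self-orthogonal, `Extⁱ(V, V) = 0` for `i ≥ 1`.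

If `N ⟶ Y ⟶ S` is a Tate `V`-coresolution, `Hom(-, V)`- and `Hom(V, -)`-exactness of `S` give that
`Hⁿ(Hom(L, S))` is the group of morphisms `L ⟶ Zⁿ(S)` modulo those which factor through `V`. A
comparison of the short exact sequences `0 ⟶ Zⁿ ⟶ Sⁿ ⟶ Zⁿ⁺¹ ⟶ 0` shows that `𝟙 (Zⁿ)` factors
through `V` for one `n` if and only if it does for every `n`, and, since `Y` and `S` agree in large
degrees, this happens if and only if `M` has finite `V`-injective dimension. If every morphism
`M ⟶ Z⁰(S)` factors through `V`, then so do the canonical maps `Zⁿ(Y) ⟶ Zⁿ(S)` for all `n`, by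
induction on `n`; for large `n` they are isomorphisms.

For `V = ℐ_C`, tensor evaluation `K ⊗ Hom(C, I) ≅ Hom(Hom(K, C), I)` at the syzygies `K` of `C`
turns `Extⁱ(C, C) = 0` into `Torᵢ(C, Hom(C, I)) = 0`, which is what self-orthogonality of `ℐ_C`
amounts to; at `K = C` it gives `C ⊗ Hom(C, I) ≅ I`, so that `ℐ_C` consists of those `X` for which
`C ⊗ X` is injective and `X ⟶ Hom(C, C ⊗ X)` is bijective, a condition inherited by summands.
-/
universe w v' u'

namespace RelativeTate

section FactorsThrough

variable {A : Type u'} [Category.{v'} A]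

/-- `f` is zero in the stable category modulo `V`: it factors through an object of `V`. -/
def FactorsThrough (V : ObjectProperty A) {X Y : A} (f : X ⟶ Y) : Prop :=
  ∃ (W : A) (a : X ⟶ W) (b : W ⟶ Y), V W ∧ a ≫ b = f

/-- Every morphism from the source of `f` to an object of `V` extends along `f`; thus a
monomorphism `f` into an object of `V` is a `V`-preenvelope. -/
def ExtendsAlong (V : ObjectProperty A) {X Y : A} (f : X ⟶ Y) : Prop :=
  ∀ W, V W → ∀ a : X ⟶ W, ∃ u : Y ⟶ W, f ≫ u = a

/-- Every morphism from an object of `V` to the target of `g` lifts along `g`; thus an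
epimorphism `g` from an object of `V` is a `V`-precover. -/
def LiftsAlong (V : ObjectProperty A) {X Y : A} (g : X ⟶ Y) : Prop :=
  ∀ W, V W → ∀ b : W ⟶ Y, ∃ u : W ⟶ X, u ≫ g = b

variable {V : ObjectProperty A}

lemma FactorsThrough.comp_left {X Y Z : A} {f : X ⟶ Y} (hf : FactorsThrough V f) (g : Z ⟶ X) :
    FactorsThrough V (g ≫ f) := by
  obtain ⟨W, a, b, hW, rfl⟩ := hf
  exact ⟨W, g ≫ a, b, hW, Category.assoc _ _ _⟩

lemma FactorsThrough.comp_right {X Y Z : A} {f : X ⟶ Y} (hf : FactorsThrough V f) (g : Y ⟶ Z) :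
    FactorsThrough V (f ≫ g) := by
  obtain ⟨W, a, b, hW, rfl⟩ := hf
  exact ⟨W, a, b ≫ g, hW, (Category.assoc _ _ _).symm⟩

lemma FactorsThrough.prop [V.IsStableUnderRetracts] {X : A} (h : FactorsThrough V (𝟙 X)) :
    V X := by
  obtain ⟨W, a, b, hW, h⟩ := h
  exact V.prop_of_retract ⟨a, b, h⟩ hW

end FactorsThrough

section Abelian

variable {A : Type u'} [Category.{v'} A] [Abelian A]

section ShortExact

/-- There is a short exact sequence `0 ⟶ X₁ ⟶ X₂ ⟶ X₃ ⟶ 0`. -/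
def IsExtension (X₁ X₂ X₃ : A) : Prop :=
  ∃ (f : X₁ ⟶ X₂) (g : X₂ ⟶ X₃) (w : f ≫ g = 0), (ShortComplex.mk f g w).ShortExact

lemma IsExtension.of_shortExact {S : ShortComplex A} (hS : S.ShortExact) :
    IsExtension S.X₁ S.X₂ S.X₃ :=
  ⟨S.f, S.g, S.zero, hS⟩

lemma IsExtension.of_iso {X₁ X₂ X₃ Y₁ Y₃ : A} (h : IsExtension X₁ X₂ X₃) (e₁ : X₁ ≅ Y₁)
    (e₃ : X₃ ≅ Y₃) : IsExtension Y₁ X₂ Y₃ := by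
  obtain ⟨f, g, w, h⟩ := h
  refine ⟨e₁.inv ≫ f, g ≫ e₃.hom, by simp [reassoc_of% w], ShortComplex.shortExact_of_iso ?_ h⟩
  exact ShortComplex.isoMk e₁ (Iso.refl _) e₃ (by simp) (by simp)

lemma isExtension_kernel {X Y : A} (f : X ⟶ Y) [Epi f] : IsExtension (kernel f) X Y :=
  ⟨kernel.ι f, f, kernel.condition f,
    { exact := ShortComplex.exact_of_f_is_kernel _ (kernelIsKernel f) }⟩

lemma isExtension_id (X : A) {Z : A} (hZ : IsZero Z) : IsExtension X X Z :=
  ⟨𝟙 X, 0, comp_zero,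
    { exact := (ShortComplex.exact_iff_epi _ rfl).2 (inferInstanceAs (Epi (𝟙 X)))
      mono_f := inferInstanceAs (Mono (𝟙 X))
      epi_g := ⟨fun _ _ _ => hZ.eq_of_src _ _⟩ }⟩

lemma exact_comp_mono_iff {X Y Z Z' : A} {f : X ⟶ Y} {g : Y ⟶ Z} (i : Z ⟶ Z') [Mono i]
    (w : f ≫ g = 0) (w' : f ≫ g ≫ i = 0) :
    (ShortComplex.mk f (g ≫ i) w').Exact ↔ (ShortComplex.mk f g w).Exact := by
  let φ : ShortComplex.mk f g w ⟶ ShortComplex.mk f (g ≫ i) w' := { τ₁ := 𝟙 _, τ₂ := 𝟙 _, τ₃ := i }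
  have : Epi φ.τ₁ := inferInstanceAs (Epi (𝟙 _))
  have : IsIso φ.τ₂ := inferInstanceAs (IsIso (𝟙 _))
  have : Mono φ.τ₃ := inferInstanceAs (Mono i)
  exact (ShortComplex.exact_iff_of_epi_of_isIso_of_mono φ).symm

lemma exact_epi_comp_iff {X' X Y Z : A} {f : X ⟶ Y} {g : Y ⟶ Z} (p : X' ⟶ X) [Epi p]
    (w : f ≫ g = 0) (w' : (p ≫ f) ≫ g = 0) :
    (ShortComplex.mk (p ≫ f) g w').Exact ↔ (ShortComplex.mk f g w).Exact := by
  let φ : ShortComplex.mk (p ≫ f) g w' ⟶ ShortComplex.mk f g w := { τ₁ := p, τ₂ := 𝟙 _, τ₃ := 𝟙 _ }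
  have : Epi φ.τ₁ := inferInstanceAs (Epi p)
  have : IsIso φ.τ₂ := inferInstanceAs (IsIso (𝟙 _))
  have : Mono φ.τ₃ := inferInstanceAs (Mono (𝟙 _))
  exact ShortComplex.exact_iff_of_epi_of_isIso_of_mono φ

variable {S T : ShortComplex A}

/-- The snake input attached to a morphism of short exact sequences, with the categorical kernel
and cokernel of that morphism as its outer rows. -/
noncomputable def snakeInput (hS : S.ShortExact) (hT : T.ShortExact) (φ : S ⟶ T) :
    ShortComplex.SnakeInput A where
  L₀ := kernel φ
  L₁ := S
  L₂ := T
  L₃ := cokernel φ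
  v₀₁ := kernel.ι φ
  v₁₂ := φ
  v₂₃ := cokernel.π φ
  w₀₂ := kernel.condition φ
  w₁₃ := cokernel.condition φ
  h₀ := kernelIsKernel φ
  h₃ := cokernelIsCokernel φ
  L₁_exact := hS.exact
  epi_L₁_g := hS.epi_g
  L₂_exact := hT.exact
  mono_L₂_f := hT.mono_f

lemma shortExact_cokernel (hS : S.ShortExact) (hT : T.ShortExact) (φ : S ⟶ T) [Mono φ.τ₃] :
    (cokernel φ).ShortExact := by
  let D := snakeInput hS hT φ
  have : Epi D.L₂.g := hT.epi_g
  have hzero : IsZero D.L₀.X₃ := by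
    have : Mono D.v₁₂.τ₃ := inferInstanceAs (Mono φ.τ₃)
    refine IsZero.of_mono_eq_zero D.v₀₁.τ₃ ?_
    rw [← cancel_mono D.v₁₂.τ₃, D.w₀₂_τ₃, zero_comp]
  exact
    { exact := D.L₃_exact
      mono_f := (ShortComplex.exact_iff_mono _ (hzero.eq_of_src _ _)).1 D.L₂'_exact
      epi_g := D.epi_L₃_g }

lemma shortExact_kernel (hS : S.ShortExact) (hT : T.ShortExact) (φ : S ⟶ T) [Epi φ.τ₁] :
    (kernel φ).ShortExact := by
  let D := snakeInput hS hT φ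
  have : Mono D.L₁.f := hS.mono_f
  have hzero : IsZero D.L₃.X₁ := by
    have : Epi D.v₁₂.τ₁ := inferInstanceAs (Epi φ.τ₁)
    refine IsZero.of_epi_eq_zero D.v₂₃.τ₁ ?_
    rw [← cancel_epi D.v₁₂.τ₁, D.w₁₃_τ₁, comp_zero]
  exact
    { exact := D.L₀_exact
      mono_f := D.mono_L₀_f
      epi_g := (ShortComplex.exact_iff_epi _ (hzero.eq_of_tgt _ _)).1 D.L₁'_exact }

lemma exists_cokernel_extension (hS : S.ShortExact) (hT : T.ShortExact) (φ : S ⟶ T) {C₁ C₃ : A}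
    {c₁ : T.X₁ ⟶ C₁} {c₃ : T.X₃ ⟶ C₃} {w₁ : φ.τ₁ ≫ c₁ = 0} {w₃ : φ.τ₃ ≫ c₃ = 0}
    (h₁ : (ShortComplex.mk _ _ w₁).ShortExact) (h₃ : (ShortComplex.mk _ _ w₃).ShortExact) :
    ∃ Q : A, IsExtension S.X₂ T.X₂ Q ∧ IsExtension C₁ Q C₃ := by
  let D := snakeInput hS hT φ
  have : Mono φ.τ₁ := h₁.mono_f
  have : Mono φ.τ₃ := h₃.mono_f
  have : Mono S.f := hS.mono_f
  have : Mono T.f := hT.mono_f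
  have : Mono φ.τ₂ := ShortComplex.mono_τ₂_of_exact_of_mono φ hS.exact
  have hτ₂ : (ShortComplex.mk φ.τ₂ D.v₂₃.τ₂ D.w₁₃_τ₂).ShortExact :=
    { exact := ShortComplex.exact_of_g_is_cokernel _ D.h₃τ₂
      epi_g := epi_of_isColimit_cofork D.h₃τ₂ }
  have hQ := IsExtension.of_shortExact (shortExact_cokernel hS hT φ)
  exact ⟨D.L₃.X₂, .of_shortExact hτ₂, hQ.of_iso
    (D.h₃τ₁.coconePointUniqueUpToIso h₁.gIsCokernel)
    (D.h₃τ₃.coconePointUniqueUpToIso h₃.gIsCokernel)⟩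

lemma exists_kernel_extension (hS : S.ShortExact) (hT : T.ShortExact) (φ : S ⟶ T) {K₁ K₃ : A}
    {k₁ : K₁ ⟶ S.X₁} {k₃ : K₃ ⟶ S.X₃} {w₁ : k₁ ≫ φ.τ₁ = 0} {w₃ : k₃ ≫ φ.τ₃ = 0}
    (h₁ : (ShortComplex.mk _ _ w₁).ShortExact) (h₃ : (ShortComplex.mk _ _ w₃).ShortExact) :
    ∃ Q : A, IsExtension Q S.X₂ T.X₂ ∧ IsExtension K₁ Q K₃ := by
  let D := snakeInput hS hT φ
  have : Epi φ.τ₁ := h₁.epi_g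
  have : Epi φ.τ₃ := h₃.epi_g
  have : Epi S.g := hS.epi_g
  have : Epi T.g := hT.epi_g
  have : Epi φ.τ₂ := ShortComplex.epi_τ₂_of_exact_of_epi φ hT.exact
  have hτ₂ : (ShortComplex.mk D.v₀₁.τ₂ φ.τ₂ D.w₀₂_τ₂).ShortExact :=
    { exact := ShortComplex.exact_of_f_is_kernel _ D.h₀τ₂
      mono_f := mono_of_isLimit_fork D.h₀τ₂
      epi_g := ‹Epi φ.τ₂› }
  have hQ := IsExtension.of_shortExact (shortExact_kernel hS hT φ)
  exact ⟨D.L₀.X₂, .of_shortExact hτ₂, hQ.of_iso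
    (D.h₀τ₁.conePointUniqueUpToIso h₁.fIsKernel)
    (D.h₀τ₃.conePointUniqueUpToIso h₃.fIsKernel)⟩

end ShortExact

section Ext

variable [HasExt.{w} A] {S : ShortComplex A} (hS : S.ShortExact) (Y : A)

open Abelian

include hS

lemma subsingleton_ext_X₂_left {n : ℕ} [Subsingleton (Ext.{w} S.X₁ Y n)]
    [Subsingleton (Ext.{w} S.X₃ Y n)] : Subsingleton (Ext.{w} S.X₂ Y n) := by
  refine subsingleton_of_forall_eq 0 fun x => ?_
  obtain ⟨y, rfl⟩ := Ext.contravariant_sequence_exact₂ hS Y x (Subsingleton.elim _ _)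
  rw [Subsingleton.elim y 0, Ext.comp_zero]

lemma subsingleton_ext_X₁_left {n m : ℕ} (h : 1 + n = m) [Subsingleton (Ext.{w} S.X₂ Y n)]
    [Subsingleton (Ext.{w} S.X₃ Y m)] : Subsingleton (Ext.{w} S.X₁ Y n) := by
  refine subsingleton_of_forall_eq 0 fun x => ?_
  obtain ⟨y, rfl⟩ := Ext.contravariant_sequence_exact₁ hS Y x h (Subsingleton.elim _ _)
  rw [Subsingleton.elim y 0, Ext.comp_zero]

lemma subsingleton_ext_X₃_left {n m : ℕ} (h : 1 + n = m) [Subsingleton (Ext.{w} S.X₁ Y n)]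
    [Subsingleton (Ext.{w} S.X₂ Y m)] : Subsingleton (Ext.{w} S.X₃ Y m) := by
  refine subsingleton_of_forall_eq 0 fun x => ?_
  obtain ⟨y, rfl⟩ := Ext.contravariant_sequence_exact₃ hS Y x (Subsingleton.elim _ _) h
  rw [Subsingleton.elim y 0, Ext.comp_zero]

lemma subsingleton_ext_X₂_right {n : ℕ} [Subsingleton (Ext.{w} Y S.X₁ n)]
    [Subsingleton (Ext.{w} Y S.X₃ n)] : Subsingleton (Ext.{w} Y S.X₂ n) := by
  refine subsingleton_of_forall_eq 0 fun x => ?_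
  obtain ⟨y, rfl⟩ := Ext.covariant_sequence_exact₂ Y hS x (Subsingleton.elim _ _)
  rw [Subsingleton.elim y 0, Ext.zero_comp]

lemma subsingleton_ext_X₁_right {n m : ℕ} (h : n + 1 = m) [Subsingleton (Ext.{w} Y S.X₂ m)]
    [Subsingleton (Ext.{w} Y S.X₃ n)] : Subsingleton (Ext.{w} Y S.X₁ m) := by
  refine subsingleton_of_forall_eq 0 fun x => ?_
  obtain ⟨y, rfl⟩ := Ext.covariant_sequence_exact₁ Y hS x (Subsingleton.elim _ _) h
  rw [Subsingleton.elim y 0, Ext.zero_comp]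

variable {Y}

lemma exists_extension_of_subsingleton_ext [Subsingleton (Ext.{w} S.X₃ Y 1)] (f : S.X₁ ⟶ Y) :
    ∃ g : S.X₂ ⟶ Y, S.f ≫ g = f := by
  obtain ⟨y, hy⟩ := Ext.contravariant_sequence_exact₁ hS Y (Ext.mk₀ f) (add_zero 1)
    (Subsingleton.elim _ _)
  obtain ⟨g, rfl⟩ := (Ext.mk₀_bijective _ _).2 y
  refine ⟨g, (Ext.mk₀_bijective _ _).1 ?_⟩
  rw [← hy, Ext.mk₀_comp_mk₀]

lemma exists_lift_of_subsingleton_ext [Subsingleton (Ext.{w} Y S.X₁ 1)] (f : Y ⟶ S.X₃) :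
    ∃ g : Y ⟶ S.X₂, g ≫ S.g = f := by
  obtain ⟨y, hy⟩ := Ext.covariant_sequence_exact₃ Y hS (Ext.mk₀ f) (zero_add 1)
    (Subsingleton.elim _ _)
  obtain ⟨g, rfl⟩ := (Ext.mk₀_bijective _ _).2 y
  refine ⟨g, (Ext.mk₀_bijective _ _).1 ?_⟩
  rw [← hy, Ext.mk₀_comp_mk₀]

lemma subsingleton_ext_one_of_exists_extension [Subsingleton (Ext.{w} S.X₂ Y 1)]
    (h : ∀ f : S.X₁ ⟶ Y, ∃ g : S.X₂ ⟶ Y, S.f ≫ g = f) : Subsingleton (Ext.{w} S.X₃ Y 1) := by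
  refine subsingleton_of_forall_eq 0 fun x => ?_
  obtain ⟨y, rfl⟩ := Ext.contravariant_sequence_exact₃ hS Y x (Subsingleton.elim _ _) (add_zero 1)
  obtain ⟨f, rfl⟩ := (Ext.mk₀_bijective _ _).2 y
  obtain ⟨g, rfl⟩ := h f
  rw [← Ext.mk₀_comp_mk₀, ShortComplex.ShortExact.extClass_comp_assoc]

lemma subsingleton_ext_one_of_exists_lift [Subsingleton (Ext.{w} Y S.X₂ 1)]
    (h : ∀ f : Y ⟶ S.X₃, ∃ g : Y ⟶ S.X₂, g ≫ S.g = f) : Subsingleton (Ext.{w} Y S.X₁ 1) := by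
  refine subsingleton_of_forall_eq 0 fun x => ?_
  obtain ⟨y, rfl⟩ := Ext.covariant_sequence_exact₁ Y hS x (Subsingleton.elim _ _) (zero_add 1)
  obtain ⟨f, rfl⟩ := (Ext.mk₀_bijective _ _).2 y
  obtain ⟨g, rfl⟩ := h f
  rw [← Ext.mk₀_comp_mk₀, Ext.comp_assoc_of_second_deg_zero, ShortComplex.ShortExact.comp_extClass,
    Ext.comp_zero]

end Ext

section Perp

variable [HasExt.{w} A] {V W : ObjectProperty A}

open Abelian

/-- The left `Ext`-orthogonal `{N | Extⁱ(N, X) = 0 for all i ≥ 1 and all X in V}`. A class `V` is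
self-orthogonal if `V ≤ leftPerp V`. -/
def leftPerp (V : ObjectProperty A) : ObjectProperty A := fun N =>
  ∀ X, V X → ∀ i : ℕ, Subsingleton (Ext.{w} N X (i + 1))

/-- The right `Ext`-orthogonal `{N | Extⁱ(X, N) = 0 for all i ≥ 1 and all X in V}`. -/
def rightPerp (V : ObjectProperty A) : ObjectProperty A := fun N =>
  ∀ X, V X → ∀ i : ℕ, Subsingleton (Ext.{w} X N (i + 1))

instance : (leftPerp.{w} V).IsClosedUnderIsomorphisms where
  of_iso {Y _} e h X hX i :=
    have : Subsingleton (((extFunctor.{w} (i + 1)).obj (Opposite.op Y)).obj X) := h X hX i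
    (((extFunctor (i + 1)).mapIso e.op).app X).addCommGroupIsoToAddEquiv.toEquiv.subsingleton

instance : (rightPerp.{w} V).IsClosedUnderIsomorphisms where
  of_iso {Y _} e h X hX i :=
    have : Subsingleton ((extFunctorObj X (i + 1)).obj Y) := h X hX i
    ((extFunctorObj X (i + 1)).mapIso e).addCommGroupIsoToAddEquiv.symm.toEquiv.subsingleton

instance : (leftPerp.{w} V).IsClosedUnderExtensions where
  prop_X₂_of_shortExact hS h₁ h₃ X hX i :=
    have := h₁ X hX i
    have := h₃ X hX i
    subsingleton_ext_X₂_left hS X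

instance : (rightPerp.{w} V).IsClosedUnderExtensions where
  prop_X₂_of_shortExact hS h₁ h₃ X hX i :=
    have := h₁ X hX i
    have := h₃ X hX i
    subsingleton_ext_X₂_right hS X

lemma leftPerp.X₁ {S : ShortComplex A} (hS : S.ShortExact) (h₂ : leftPerp.{w} V S.X₂)
    (h₃ : leftPerp.{w} V S.X₃) : leftPerp.{w} V S.X₁ := fun X hX i =>
  have := h₂ X hX i
  have := h₃ X hX (i + 1)
  subsingleton_ext_X₁_left hS X (Nat.add_comm 1 (i + 1))

end Perp

section Stable

/-- `X` is a retract of `Y` in the stable category modulo `V`. -/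
def IsStableRetract (V : ObjectProperty A) (X Y : A) : Prop :=
  ∃ (f : X ⟶ Y) (g : Y ⟶ X), FactorsThrough V (𝟙 X - f ≫ g)

variable {V : ObjectProperty A}

lemma FactorsThrough.add [V.IsClosedUnderBinaryProducts] {X Y : A} {f g : X ⟶ Y}
    (hf : FactorsThrough V f) (hg : FactorsThrough V g) : FactorsThrough V (f + g) := by
  obtain ⟨W, a, b, hW, rfl⟩ := hf
  obtain ⟨W', a', b', hW', rfl⟩ := hg
  exact ⟨W ⊞ W', biprod.lift a a', biprod.desc b b',
    V.prop_of_isLimit_binaryFan (BinaryBiproduct.isLimit W W') hW hW', by simp⟩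

lemma FactorsThrough.τ₃ {S T : ShortComplex A} (hS : S.ShortExact) (φ : S ⟶ T) (hT : V T.X₂)
    (hext : ExtendsAlong V S.f) (h : FactorsThrough V φ.τ₁) : FactorsThrough V φ.τ₃ := by
  obtain ⟨W, a, b, hW, hab⟩ := h
  obtain ⟨u, rfl⟩ := hext W hW a
  have := hS.epi_g
  have hk : S.f ≫ (φ.τ₂ - u ≫ b ≫ T.f) = 0 := by
    simp [Preadditive.comp_sub, ← φ.comm₁₂, ← hab]
  refine ⟨T.X₂, hS.exact.desc _ hk, T.g, hT, ?_⟩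
  rw [← cancel_epi S.g, hS.exact.g_desc_assoc]
  simp [Preadditive.sub_comp, φ.comm₂₃]

lemma FactorsThrough.τ₁ {S T : ShortComplex A} (hT : T.ShortExact) (φ : S ⟶ T) (hS : V S.X₂)
    (hlift : LiftsAlong V T.g) (h : FactorsThrough V φ.τ₃) : FactorsThrough V φ.τ₁ := by
  obtain ⟨W, a, b, hW, hab⟩ := h
  obtain ⟨u, rfl⟩ := hlift W hW b
  have := hT.mono_f
  have hk : (φ.τ₂ - S.g ≫ a ≫ u) ≫ T.g = 0 := by
    simp [Preadditive.sub_comp, φ.comm₂₃, ← hab]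
  refine ⟨S.X₂, S.f, hT.exact.lift _ hk, hS, ?_⟩
  rw [← cancel_mono T.f, Category.assoc, hT.exact.lift_f]
  simp [Preadditive.comp_sub, φ.comm₁₂]

lemma ExtendsAlong.exists_hom {S T : ShortComplex A} (hS : S.ShortExact)
    (hext : ExtendsAlong V S.f) (hT : V T.X₂) (f : S.X₁ ⟶ T.X₁) : ∃ φ : S ⟶ T, φ.τ₁ = f := by
  have := hS.epi_g
  obtain ⟨k, hk⟩ := hext _ hT (f ≫ T.f)
  have hk' : S.f ≫ k ≫ T.g = 0 := by rw [reassoc_of% hk, T.zero, comp_zero]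
  exact ⟨⟨f, k, hS.exact.desc _ hk', hk.symm, (hS.exact.g_desc _ hk').symm⟩, rfl⟩

lemma LiftsAlong.exists_hom {S T : ShortComplex A} (hT : T.ShortExact)
    (hlift : LiftsAlong V T.g) (hS : V S.X₂) (f : S.X₃ ⟶ T.X₃) : ∃ φ : S ⟶ T, φ.τ₃ = f := by
  have := hT.mono_f
  obtain ⟨k, hk⟩ := hlift _ hS (S.g ≫ f)
  have hk' : (S.f ≫ k) ≫ T.g = 0 := by rw [Category.assoc, hk, S.zero_assoc, zero_comp]
  exact ⟨⟨hT.exact.lift _ hk', k, f, hT.exact.lift_f _ hk', hk⟩, rfl⟩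

lemma IsStableRetract.of_iso [V.ContainsZero] {X Y : A} (e : X ≅ Y) : IsStableRetract V X Y := by
  obtain ⟨Z, -, hZ⟩ := ‹V.ContainsZero›.exists_zero
  exact ⟨e.hom, e.inv, Z, 0, 0, hZ, by simp⟩

lemma IsStableRetract.of_iso_right {X Y Y' : A} (h : IsStableRetract V X Y) (e : Y ≅ Y') :
    IsStableRetract V X Y' := by
  obtain ⟨f, g, h⟩ := h
  exact ⟨f ≫ e.hom, e.inv ≫ g, by simpa using h⟩

lemma IsStableRetract.X₃ {S T : ShortComplex A} (hS : S.ShortExact) (hT : T.ShortExact)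
    (hS₂ : V S.X₂) (hT₂ : V T.X₂) (hS' : ExtendsAlong V S.f) (hT' : ExtendsAlong V T.f)
    (h : IsStableRetract V S.X₁ T.X₁) : IsStableRetract V S.X₃ T.X₃ := by
  obtain ⟨f, g, h⟩ := h
  obtain ⟨φ, rfl⟩ := hS'.exists_hom hS hT₂ f
  obtain ⟨ψ, rfl⟩ := hT'.exists_hom hT hS₂ g
  exact ⟨φ.τ₃, ψ.τ₃, FactorsThrough.τ₃ hS (𝟙 S - φ ≫ ψ) hS₂ hS' h⟩

lemma IsStableRetract.X₁ {S T : ShortComplex A} (hS : S.ShortExact) (hT : T.ShortExact)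
    (hS₂ : V S.X₂) (hT₂ : V T.X₂) (hS' : LiftsAlong V S.g) (hT' : LiftsAlong V T.g)
    (h : IsStableRetract V S.X₃ T.X₃) : IsStableRetract V S.X₁ T.X₁ := by
  obtain ⟨f, g, h⟩ := h
  obtain ⟨φ, rfl⟩ := hT'.exists_hom hT hS₂ f
  obtain ⟨ψ, rfl⟩ := hS'.exists_hom hS hT₂ g
  exact ⟨φ.τ₁, ψ.τ₁, FactorsThrough.τ₁ hS (𝟙 S - φ ≫ ψ) hS₂ hS' h⟩

lemma IsStableRetract.factorsThrough [V.IsClosedUnderBinaryProducts] {M X Y : A}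
    (h : IsStableRetract V X Y) (hM : ∀ f : M ⟶ Y, FactorsThrough V f) (f : M ⟶ X) :
    FactorsThrough V f := by
  obtain ⟨a, b, h⟩ := h
  simpa [Preadditive.comp_sub] using (h.comp_left f).add ((hM (f ≫ a)).comp_right b)

variable [HasExt.{w} A] {S : ShortComplex A}

lemma leftPerp.extendsAlong (hS : S.ShortExact) (h : leftPerp.{w} V S.X₃) :
    ExtendsAlong V S.f := fun W hW a =>
  have := h W hW 0
  exists_extension_of_subsingleton_ext hS a

lemma rightPerp.liftsAlong (hS : S.ShortExact) (h : rightPerp.{w} V S.X₁) :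
    LiftsAlong V S.g := fun W hW a =>
  have := h W hW 0
  exists_lift_of_subsingleton_ext hS a

end Stable

section Complexes

variable {ι : Type*} {c : ComplexShape ι} (K : HomologicalComplex A c) {i j k : ι}

variable {K} in
lemma exactAt_iff_of_d_eq (hi : c.prev j = i) (hk : c.next j = k) {f : K.X i ⟶ K.X j}
    {g : K.X j ⟶ K.X k} (hf : K.d i j = f) (hg : K.d j k = g) (w : f ≫ g = 0) :
    K.ExactAt j ↔ (ShortComplex.mk f g w).Exact := by
  subst hf hg
  exact K.exactAt_iff' i j k hi hk

lemma exactAt_homFrom_iff (X : A) (hi : c.prev j = i) (hk : c.next j = k) :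
    (homFrom X K).ExactAt j ↔
      ∀ f : X ⟶ K.X j, f ≫ K.d j k = 0 → ∃ g : X ⟶ K.X i, g ≫ K.d i j = f := by
  rw [HomologicalComplex.exactAt_iff' _ i j k hi hk, ShortComplex.ab_exact_iff]
  rfl

lemma exactAt_homTo_iff (X : A) (hi : c.prev j = i) (hk : c.next j = k) :
    (homTo K X).ExactAt j ↔
      ∀ f : K.X j ⟶ X, K.d i j ≫ f = 0 → ∃ g : K.X k ⟶ X, K.d j k ≫ g = f := by
  rw [HomologicalComplex.exactAt_iff' (c := c.symm) _ k j i hk hi, ShortComplex.ab_exact_iff]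
  rfl

/-- The sequence `0 ⟶ Zʲ ⟶ Kʲ ⟶ Zᵏ ⟶ 0` of a complex `K`, where `k` is meant to be the degree
following `j`. -/
noncomputable abbrev cyclesSequence (j k : ι) : ShortComplex A :=
  ShortComplex.mk (K.iCycles j) (K.toCycles j k) (by simp [← cancel_mono (K.iCycles k)])

variable {K}

lemma shortExact_cyclesSequence (hjk : c.Rel j k) (hK : K.ExactAt k) :
    (cyclesSequence K j k).ShortExact where
  exact := by
    refine (exact_comp_mono_iff (K.iCycles k) _ (by simp)).1 ?_
    simpa only [HomologicalComplex.toCycles_i] using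
      ShortComplex.exact_of_f_is_kernel _ (K.cyclesIsKernel j k (c.next_eq' hjk))
  mono_f := inferInstanceAs (Mono (K.iCycles j))
  epi_g := by
    rw [K.exactAt_iff' j k _ (c.prev_eq' hjk) rfl, ShortComplex.exact_iff_epi_toCycles,
      ← K.toCycles_cyclesIsoSc'_hom j k _ (c.prev_eq' hjk) rfl] at hK
    exact (epi_comp_iff_of_isIso _ _).1 hK

/-- The cokernel of a differential of an exact complex, as an object of cycles. -/
noncomputable def cokernelIsoCycles (hij : c.Rel i j) (hjk : c.Rel j k) (hj : K.ExactAt j)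
    (hk : K.ExactAt k) : cokernel (K.d i j) ≅ K.cycles k :=
  have := (shortExact_cyclesSequence hij hj).epi_g
  IsColimit.coconePointUniqueUpToIso (cokernelIsCokernel (K.d i j))
    (isCokernelEpiComp (shortExact_cyclesSequence hjk hk).gIsCokernel (K.toCycles i j) (by simp))

variable {V : ObjectProperty A}

lemma liftsAlong_toCycles (hV : IsHomFromExact V K) (hjk : c.Rel j k) :
    LiftsAlong V (K.toCycles j k) := fun W hW b => by
  obtain ⟨g, hg⟩ := (exactAt_homFrom_iff K W (c.prev_eq' hjk) rfl).1 (hV W hW k)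
    (b ≫ K.iCycles k) (by simp)
  exact ⟨g, by rw [← cancel_mono (K.iCycles k), Category.assoc, K.toCycles_i, hg]⟩

lemma extendsAlong_iCycles (hV : IsHomToExact V K) (hjk : c.Rel j k) (hK : K.ExactAt k) :
    ExtendsAlong V (K.iCycles k) := fun W hW a => by
  obtain ⟨g, hg⟩ := (exactAt_homTo_iff K W rfl (c.next_eq' hjk)).1 (hV W hW j)
    (K.toCycles j k ≫ a) (by simp)
  have := (shortExact_cyclesSequence hjk hK).epi_g
  exact ⟨g, by rw [← cancel_epi (K.toCycles j k), ← Category.assoc, K.toCycles_i, hg]⟩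

end Complexes

section Reindex

/-- The complex `S` with `S.X (n + k)` placed in degree `n`. Unlike for the shift of complexes, no
sign is introduced in the differentials. -/
def reindex (S : CochainComplex A ℤ) (k : ℤ) : CochainComplex A ℤ where
  X n := S.X (n + k)
  d i j := S.d (i + k) (j + k)
  shape i j h := S.shape _ _ fun h' => h (by rw [ComplexShape.up_Rel] at h' ⊢; omega)

variable {V : ObjectProperty A} {S : CochainComplex A ℤ}

lemma IsTotallyAcyclic.reindex (hS : IsTotallyAcyclic V S) (k : ℤ) :
    IsTotallyAcyclic V (reindex S k) := by
  have prev (n : ℤ) : (ComplexShape.up ℤ).prev (n + k) = n - 1 + k := by simp; ring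
  have next (n : ℤ) : (ComplexShape.up ℤ).next (n + k) = n + 1 + k := by simp; ring
  refine ⟨fun n => hS.mem (n + k), fun n => ?_, fun X hX n => ?_, fun X hX n => ?_⟩
  · rw [HomologicalComplex.exactAt_iff' _ (n - 1) n (n + 1) (by simp) (by simp)]
    exact (S.exactAt_iff' _ _ _ (prev n) (next n)).1 (hS.exact (n + k))
  · rw [exactAt_homFrom_iff _ X (i := n - 1) (k := n + 1) (by simp) (by simp)]
    exact (exactAt_homFrom_iff S X (prev n) (next n)).1 (hS.homFrom_exact X hX (n + k))
  · rw [exactAt_homTo_iff _ X (i := n - 1) (k := n + 1) (by simp) (by simp)]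
    exact (exactAt_homTo_iff S X (prev n) (next n)).1 (hS.homTo_exact X hX (n + k))

end Reindex

section Splice

variable {Z X : ℤ → A} (i : ∀ n, Z n ⟶ X n) (p : ∀ n, X n ⟶ Z (n + 1)) (w : ∀ n, i n ≫ p n = 0)

/-- The complex spliced from the sequences `0 ⟶ Zⁿ ⟶ Xⁿ ⟶ Zⁿ⁺¹ ⟶ 0`. -/
noncomputable abbrev splice : CochainComplex A ℤ :=
  CochainComplex.of X (fun n => p n ≫ i (n + 1)) fun n => by simp [reassoc_of% (w (n + 1))]

lemma splice_d (n : ℤ) : (splice i p w).d n (n + 1) = p n ≫ i (n + 1) :=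
  CochainComplex.of_d X (fun n => p n ≫ i (n + 1)) n

variable {i p w} (h : ∀ n, (ShortComplex.mk (i n) (p n) (w n)).ShortExact)

include h

lemma acyclic_splice : (splice i p w).Acyclic := fun n => by
  obtain ⟨m, rfl⟩ : ∃ m, n = m + 1 := ⟨n - 1, by simp⟩
  have : Mono (i (m + 1 + 1)) := (h (m + 1 + 1)).mono_f
  have : Epi (p m) := (h m).epi_g
  have hw : i (m + 1) ≫ p (m + 1) ≫ i (m + 1 + 1) = 0 := by rw [reassoc_of% w, zero_comp]
  have hw' : (p m ≫ i (m + 1)) ≫ p (m + 1) ≫ i (m + 1 + 1) = 0 := by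
    rw [Category.assoc, hw, comp_zero]
  rw [exactAt_iff_of_d_eq (by simp) (by simp) (splice_d i p w m) (splice_d i p w (m + 1)) hw',
    exact_epi_comp_iff (p m) hw, exact_comp_mono_iff (i (m + 1 + 1)) (w (m + 1))]
  exact (h (m + 1)).exact

variable {V : ObjectProperty A}

lemma isHomFromExact_splice (hp : ∀ n, LiftsAlong V (p n)) : IsHomFromExact V (splice i p w) :=
  fun W hW n => by
    obtain ⟨m, rfl⟩ : ∃ m, n = m + 1 := ⟨n - 1, by simp⟩
    rw [exactAt_homFrom_iff _ _ (i := m) (k := m + 1 + 1) (by simp) (by simp)]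
    intro f hf
    have : Mono (i (m + 1 + 1)) := (h (m + 1 + 1)).mono_f
    have := (h (m + 1)).mono_f
    have hf' : f ≫ p (m + 1) = 0 := by
      rw [← cancel_mono (i (m + 1 + 1)), Category.assoc, ← splice_d i p w, hf, zero_comp]
    obtain ⟨g, hg⟩ := hp m W hW ((h (m + 1)).exact.lift f hf')
    exact ⟨g, by rw [splice_d, reassoc_of% hg]; exact (h (m + 1)).exact.lift_f f hf'⟩

lemma isHomToExact_splice (hi : ∀ n, ExtendsAlong V (i n)) : IsHomToExact V (splice i p w) :=
  fun W hW n => by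
    obtain ⟨m, rfl⟩ : ∃ m, n = m + 1 := ⟨n - 1, by simp⟩
    rw [exactAt_homTo_iff _ _ (i := m) (k := m + 1 + 1) (by simp) (by simp)]
    intro f hf
    have : Epi (p m) := (h m).epi_g
    have := (h (m + 1)).epi_g
    have hf' : i (m + 1) ≫ f = 0 := by
      rw [← cancel_epi (p m), ← Category.assoc, ← splice_d i p w, hf, comp_zero]
    obtain ⟨g, hg⟩ := hi (m + 1 + 1) W hW ((h (m + 1)).exact.desc f hf')
    exact ⟨g, by rw [splice_d, Category.assoc, hg]; exact (h (m + 1)).exact.g_desc f hf'⟩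

/-- The cycles of a spliced complex. -/
noncomputable def isoCyclesSplice (n : ℤ) : Z n ≅ (splice i p w).cycles n :=
  have : Mono (i (n + 1)) := (h (n + 1)).mono_f
  IsLimit.conePointUniqueUpToIso
    (isKernelCompMono (h n).fIsKernel (i (n + 1)) (splice_d i p w n))
    ((splice i p w).cyclesIsKernel n (n + 1) (by simp))

end Splice

section Gorenstein

variable {V : ObjectProperty A}

/-- `K` is a `V`-syzygy of `G`: there is a short exact sequence `0 ⟶ K ⟶ X ⟶ G ⟶ 0` with `X`
in `V`. -/
def IsSyzygy (V : ObjectProperty A) (K G : A) : Prop :=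
  ∃ X, V X ∧ IsExtension K X G

lemma IsSyzygy.of_iso {K K' G G' : A} (h : IsSyzygy V K G) (e : K ≅ K') (e' : G ≅ G') :
    IsSyzygy V K' G' := by
  obtain ⟨X, hX, h⟩ := h
  exact ⟨X, hX, h.of_iso e e'⟩

namespace IsTotallyAcyclic

variable {S : CochainComplex A ℤ} (hS : IsTotallyAcyclic V S)

include hS

lemma shortExact {j k : ℤ} (h : j + 1 = k) : (cyclesSequence S j k).ShortExact :=
  shortExact_cyclesSequence h (hS.exact k)

lemma extendsAlong (k : ℤ) : ExtendsAlong V (S.iCycles k) :=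
  extendsAlong_iCycles (j := k - 1) hS.homTo_exact (by simp) (hS.exact k)

lemma liftsAlong {j k : ℤ} (h : j + 1 = k) : LiftsAlong V (S.toCycles j k) :=
  liftsAlong_toCycles hS.homFrom_exact h

lemma isSyzygy {j k : ℤ} (h : j + 1 = k) : IsSyzygy V (S.cycles j) (S.cycles k) :=
  ⟨S.X j, hS.mem j, .of_shortExact (hS.shortExact h)⟩

lemma gorenstein_cycles (n : ℤ) : gorenstein V (S.cycles n) :=
  ⟨RelativeTate.reindex S (n - 1), hS.reindex (n - 1),
    ⟨(cokernelIsoCycles (i := -1 + (n - 1)) (j := 0 + (n - 1)) (by simp) (by simp) (hS.exact _)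
      (hS.exact n)).symm⟩⟩

variable [HasExt.{w} A]

lemma leftPerp_cycles (hV : V ≤ leftPerp.{w} V) (n : ℤ) : leftPerp.{w} V (S.cycles n) :=
  fun W hW i => by
    induction i generalizing n with
    | zero =>
      have := hV _ (hS.mem (n - 1)) W hW 0
      exact subsingleton_ext_one_of_exists_extension (hS.shortExact (sub_add_cancel n 1))
        fun f => hS.extendsAlong (n - 1) W hW f
    | succ i ih =>
      have := hV _ (hS.mem (n - 1)) W hW (i + 1)
      have := ih (n - 1)
      exact subsingleton_ext_X₃_left (hS.shortExact (sub_add_cancel n 1)) W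
        (Nat.add_comm 1 (i + 1))

lemma rightPerp_cycles (hV : V ≤ leftPerp.{w} V) (n : ℤ) : rightPerp.{w} V (S.cycles n) :=
  fun W hW i => by
    induction i generalizing n with
    | zero =>
      have := hV W hW _ (hS.mem n) 0
      exact subsingleton_ext_one_of_exists_lift (hS.shortExact rfl)
        fun f => hS.liftsAlong rfl W hW f
    | succ i ih =>
      have := hV W hW _ (hS.mem n) (i + 1)
      have := ih (n + 1)
      exact subsingleton_ext_X₁_right (hS.shortExact rfl) W rfl

end IsTotallyAcyclic

instance : (gorenstein V).IsClosedUnderIsomorphisms where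
  of_iso e := fun ⟨S, hS, ⟨e'⟩⟩ => ⟨S, hS, ⟨e.symm ≪≫ e'⟩⟩

lemma gorenstein.exists_iso_cycles {G : A} (hG : gorenstein V G) :
    ∃ S : CochainComplex A ℤ, IsTotallyAcyclic V S ∧ Nonempty (G ≅ S.cycles 0) := by
  obtain ⟨S, hS, ⟨e⟩⟩ := hG
  have hS' := hS.reindex 1
  exact ⟨reindex S 1, hS', ⟨e ≪≫ (cokernelIsoCycles (K := reindex S 1) (i := -2) (j := -1)
    (by simp) (by simp) (hS'.exact _) (hS'.exact 0) :)⟩⟩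

lemma gorenstein.exists_cosyzygy {G : A} (hG : gorenstein V G) :
    ∃ G', gorenstein V G' ∧ IsSyzygy V G G' := by
  obtain ⟨S, hS, ⟨e⟩⟩ := hG.exists_iso_cycles
  exact ⟨S.cycles 1, hS.gorenstein_cycles 1,
    (hS.isSyzygy (zero_add 1)).of_iso e.symm (Iso.refl _)⟩

lemma gorenstein.exists_syzygy {G : A} (hG : gorenstein V G) :
    ∃ G', gorenstein V G' ∧ IsSyzygy V G' G := by
  obtain ⟨S, hS, ⟨e⟩⟩ := hG.exists_iso_cycles
  exact ⟨S.cycles (-1), hS.gorenstein_cycles (-1),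
    (hS.isSyzygy (neg_add_cancel 1)).of_iso (Iso.refl _) e.symm⟩

lemma exists_int_sequence {α : Type*} {r : α → α → Prop} (hup : ∀ a, ∃ b, r a b)
    (hdown : ∀ b, ∃ a, r a b) (a : α) : ∃ Z : ℤ → α, Z 0 = a ∧ ∀ n, r (Z n) (Z (n + 1)) := by
  choose up hup using hup
  choose down hdown using hdown
  let Z : ℤ → α
    | .ofNat n => up^[n] a
    | .negSucc n => down^[n + 1] a
  refine ⟨Z, rfl, fun n => ?_⟩
  match n with
  | .ofNat n =>
    have : Z (.ofNat n + 1) = up (Z (.ofNat n)) := Function.iterate_succ_apply' _ _ _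
    exact this ▸ hup _
  | .negSucc 0 => exact hdown a
  | .negSucc (n + 1) =>
    have : Z (.negSucc (n + 1)) = down (Z (.negSucc n)) := Function.iterate_succ_apply' _ _ _
    exact this ▸ hdown _

variable [HasExt.{w} A]

lemma gorenstein_le_leftPerp (hV : V ≤ leftPerp.{w} V) : gorenstein V ≤ leftPerp.{w} V :=
  fun _ hG =>
    let ⟨_, hS, ⟨e⟩⟩ := hG.exists_iso_cycles
    (leftPerp V).prop_of_iso e.symm (hS.leftPerp_cycles hV 0)

lemma gorenstein_le_rightPerp (hV : V ≤ leftPerp.{w} V) : gorenstein V ≤ rightPerp.{w} V :=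
  fun _ hG =>
    let ⟨_, hS, ⟨e⟩⟩ := hG.exists_iso_cycles
    (rightPerp V).prop_of_iso e.symm (hS.rightPerp_cycles hV 0)

lemma le_gorenstein_of_exists_syzygy (P : ObjectProperty A) (hl : P ≤ leftPerp.{w} V)
    (hr : P ≤ rightPerp.{w} V) (hup : ∀ G, P G → ∃ G', P G' ∧ IsSyzygy V G G')
    (hdown : ∀ G, P G → ∃ G', P G' ∧ IsSyzygy V G' G) : P ≤ gorenstein V := by
  intro G hG
  obtain ⟨Z, hZ, h⟩ := exists_int_sequence (α := Subtype P) (r := fun G G' => IsSyzygy V G.1 G'.1)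
    (fun G => let ⟨G', hG', h⟩ := hup G.1 G.2; ⟨⟨G', hG'⟩, h⟩)
    (fun G => let ⟨G', hG', h⟩ := hdown G.1 G.2; ⟨⟨G', hG'⟩, h⟩) ⟨G, hG⟩
  choose X hX i p w h using h
  have hS : IsTotallyAcyclic V (splice i p w) :=
    { mem := hX
      exact := acyclic_splice h
      homFrom_exact := isHomFromExact_splice h fun n => (hr _ (Z n).2).liftsAlong (h n)
      homTo_exact := isHomToExact_splice h fun n => (hl _ (Z (n + 1)).2).extendsAlong (h n) }
  have hZ₀ := (gorenstein V).prop_of_iso (isoCyclesSplice h 0).symm (hS.gorenstein_cycles 0)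
  rwa [hZ] at hZ₀

section Horseshoe

variable [V.IsClosedUnderBinaryProducts] {X₁ X₂ X₃ Y₁ Y₃ : A}

lemma IsExtension.exists_cosyzygy (h : IsExtension X₁ X₂ X₃) (h₁ : IsSyzygy V X₁ Y₁)
    (h₃ : IsSyzygy V X₃ Y₃) (hX₃ : leftPerp.{w} V X₃) :
    ∃ Y₂, IsSyzygy V X₂ Y₂ ∧ IsExtension Y₁ Y₂ Y₃ := by
  obtain ⟨f, g, w, h⟩ := h
  obtain ⟨W₁, hW₁, f₁, g₁, w₁, h₁⟩ := h₁
  obtain ⟨W₃, hW₃, f₃, g₃, w₃, h₃⟩ := h₃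
  obtain ⟨u, hu : f ≫ u = f₁⟩ := hX₃.extendsAlong h W₁ hW₁ f₁
  obtain ⟨Q, hQ, hQ'⟩ := exists_cokernel_extension h
    (ShortComplex.Splitting.ofHasBinaryBiproduct W₁ W₃).shortExact
    { τ₁ := f₁
      τ₂ := biprod.lift u (g ≫ f₃)
      τ₃ := f₃
      comm₁₂ := by ext <;> simp [hu, reassoc_of% w]
      comm₂₃ := by simp } h₁ h₃
  exact ⟨Q, ⟨_, V.prop_of_isLimit_binaryFan (BinaryBiproduct.isLimit W₁ W₃) hW₁ hW₃, hQ⟩, hQ'⟩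

lemma IsExtension.exists_syzygy (h : IsExtension X₁ X₂ X₃) (h₁ : IsSyzygy V Y₁ X₁)
    (h₃ : IsSyzygy V Y₃ X₃) (hX₁ : rightPerp.{w} V X₁) :
    ∃ Y₂, IsSyzygy V Y₂ X₂ ∧ IsExtension Y₁ Y₂ Y₃ := by
  obtain ⟨f, g, w, h⟩ := h
  obtain ⟨W₁, hW₁, f₁, g₁, w₁, h₁⟩ := h₁
  obtain ⟨W₃, hW₃, f₃, g₃, w₃, h₃⟩ := h₃
  obtain ⟨u, hu : u ≫ g = g₃⟩ := hX₁.liftsAlong h W₃ hW₃ g₃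
  obtain ⟨Q, hQ, hQ'⟩ := exists_kernel_extension
    (ShortComplex.Splitting.ofHasBinaryBiproduct W₁ W₃).shortExact h
    { τ₁ := g₁
      τ₂ := biprod.desc (g₁ ≫ f) u
      τ₃ := g₃
      comm₁₂ := by simp
      comm₂₃ := by ext <;> simp [hu, w] } h₁ h₃
  exact ⟨Q, ⟨_, V.prop_of_isLimit_binaryFan (BinaryBiproduct.isLimit W₁ W₃) hW₁ hW₃, hQ⟩, hQ'⟩

lemma gorenstein_isClosedUnderExtensions (hV : V ≤ leftPerp.{w} V) :
    (gorenstein V).IsClosedUnderExtensions where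
  prop_X₂_of_shortExact hS h₁ h₃ := by
    have hl := gorenstein_le_leftPerp hV
    have hr := gorenstein_le_rightPerp hV
    refine le_gorenstein_of_exists_syzygy.{w}
      (fun Q => ∃ X₁ X₃, gorenstein V X₁ ∧ gorenstein V X₃ ∧ IsExtension X₁ Q X₃) ?_ ?_ ?_ ?_ _
      ⟨_, _, h₁, h₃, .of_shortExact hS⟩
    · rintro Q ⟨X₁, X₃, h₁, h₃, _, _, _, h⟩
      exact (leftPerp V).prop_X₂_of_shortExact h (hl _ h₁) (hl _ h₃)
    · rintro Q ⟨X₁, X₃, h₁, h₃, _, _, _, h⟩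
      exact (rightPerp V).prop_X₂_of_shortExact h (hr _ h₁) (hr _ h₃)
    · rintro Q ⟨X₁, X₃, h₁, h₃, h⟩
      obtain ⟨Y₁, hY₁, e₁⟩ := h₁.exists_cosyzygy
      obtain ⟨Y₃, hY₃, e₃⟩ := h₃.exists_cosyzygy
      obtain ⟨Y, hY, e⟩ := h.exists_cosyzygy e₁ e₃ (hl _ h₃)
      exact ⟨Y, ⟨Y₁, Y₃, hY₁, hY₃, e⟩, hY⟩
    · rintro Q ⟨X₁, X₃, h₁, h₃, h⟩
      obtain ⟨Y₁, hY₁, e₁⟩ := h₁.exists_syzygy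
      obtain ⟨Y₃, hY₃, e₃⟩ := h₃.exists_syzygy
      obtain ⟨Y, hY, e⟩ := h.exists_syzygy e₁ e₃ (hr _ h₁)
      exact ⟨Y, ⟨Y₁, Y₃, hY₁, hY₃, e⟩, hY⟩

end Horseshoe

end Gorenstein

section Augment

lemma acyclic_iff (K : CochainComplex A ℕ) :
    K.Acyclic ↔ Mono (K.d 0 1) ∧ ∀ n,
      (ShortComplex.mk (K.d n (n + 1)) (K.d (n + 1) (n + 2)) (K.d_comp_d _ _ _)).Exact := by
  refine Nat.and_forall_add_one.symm.trans (and_congr ?_ (forall_congr' fun n => ?_))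
  · rw [K.exactAt_iff' 0 0 1 (by simp) (by simp)]
    exact ShortComplex.exact_iff_mono _ (K.shape _ _ (by simp))
  · exact K.exactAt_iff' n (n + 1) (n + 2) (by simp) (by simp)

lemma isHomToExact_iff (V : ObjectProperty A) (K : CochainComplex A ℕ) :
    IsHomToExact V K ↔ ExtendsAlong V (K.d 0 1) ∧ ∀ n W, V W → ∀ b : K.X (n + 1) ⟶ W,
      K.d n (n + 1) ≫ b = 0 → ∃ g : K.X (n + 2) ⟶ W, K.d (n + 1) (n + 2) ≫ g = b := by
  have h₀ (W : A) : (homTo K W).ExactAt 0 ↔ ∀ a : K.X 0 ⟶ W, ∃ u, K.d 0 1 ≫ u = a := by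
    rw [exactAt_homTo_iff K W (i := 0) (j := 0) (k := 1) (by simp) (by simp)]
    simp
  have h₁ (W : A) (n : ℕ) : (homTo K W).ExactAt (n + 1) ↔ _ :=
    exactAt_homTo_iff K W (i := n) (k := n + 2) (by simp) (by simp)
  refine ⟨fun h => ⟨fun W hW => (h₀ W).1 (h W hW 0), fun n W hW => (h₁ W n).1 (h W hW (n + 1))⟩,
    fun h W hW => Nat.and_forall_add_one.1 ⟨(h₀ W).2 (h.1 W hW), fun n => (h₁ W n).2 (h.2 n W hW)⟩⟩

end Augment

namespace Coresolution

variable {V : ObjectProperty A} {N : A} (Y : Coresolution V N)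

lemma shortExact (n : ℕ) : (cyclesSequence Y.complex n (n + 1)).ShortExact :=
  shortExact_cyclesSequence rfl ((Y.complex.exactAt_iff' n (n + 1) (n + 2) (by simp)
    (by simp)).2 (((acyclic_iff _).1 Y.exact).2 (n + 1)))

/-- The zeroth cycles of a coresolution of `N`. -/
noncomputable def isoCycles : N ≅ Y.complex.cycles 0 :=
  have h := (acyclic_iff _).1 Y.exact
  have : Mono Y.ι := h.1
  have hι : (ShortComplex.mk Y.ι (Y.complex.d 0 1) Y.ι_d).Exact := h.2 0
  IsLimit.conePointUniqueUpToIso hι.fIsKernel (Y.complex.cyclesIsKernel 0 1 (by simp))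

@[simp]
lemma isoCycles_hom_iCycles : Y.isoCycles.hom ≫ Y.complex.iCycles 0 = Y.ι :=
  IsLimit.conePointUniqueUpToIso_hom_comp _ _ WalkingParallelPair.zero

lemma length_le_iff {d : ℕ} : Y.length ≤ d ↔ ∀ n, d < n → IsZero (Y.complex.X n) := by
  simp only [length, iSup_le_iff, Nat.cast_le]
  exact forall_congr' fun n => by rw [not_imp_comm, not_le]

lemma isProper_iff : Y.IsProper ↔ ExtendsAlong V Y.ι ∧
    (∀ W, V W → ∀ b : Y.complex.X 0 ⟶ W, Y.ι ≫ b = 0 → ∃ g, Y.complex.d 0 1 ≫ g = b) ∧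
    ∀ n W, V W → ∀ b : Y.complex.X (n + 1) ⟶ W, Y.complex.d n (n + 1) ≫ b = 0 →
      ∃ g, Y.complex.d (n + 1) (n + 2) ≫ g = b :=
  (isHomToExact_iff V Y.augmented).trans (and_congr_right' Nat.and_forall_add_one.symm)

variable {Y} in
lemma IsProper.extendsAlong (hY : Y.IsProper) : ∀ n, ExtendsAlong V (Y.complex.iCycles n)
  | 0 => fun W hW a => by
    obtain ⟨u, hu⟩ := (Y.isProper_iff.1 hY).1 W hW (Y.isoCycles.hom ≫ a)
    exact ⟨u, by rw [← cancel_epi Y.isoCycles.hom, ← Category.assoc, isoCycles_hom_iCycles, hu]⟩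
  | 1 => fun W hW a => by
    have := (Y.shortExact 0).epi_g
    have hι : Y.ι ≫ Y.complex.toCycles 0 1 = 0 := by
      simp [← cancel_mono (Y.complex.iCycles 1), Y.ι_d]
    obtain ⟨u, hu⟩ := (Y.isProper_iff.1 hY).2.1 W hW (Y.complex.toCycles 0 1 ≫ a)
      (by rw [reassoc_of% hι, zero_comp])
    exact ⟨u, by rw [← cancel_epi (Y.complex.toCycles 0 1), ← Category.assoc,
      Y.complex.toCycles_i, hu]⟩
  | n + 2 => fun W hW a => by
    have := (Y.shortExact (n + 1)).epi_g
    obtain ⟨u, hu⟩ := (Y.isProper_iff.1 hY).2.2 n W hW (Y.complex.toCycles (n + 1) (n + 2) ≫ a)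
      (by simp)
    exact ⟨u, by rw [← cancel_epi (Y.complex.toCycles (n + 1) (n + 2)), ← Category.assoc,
      Y.complex.toCycles_i, hu]⟩

section Cons

variable {X M : A} {f : M ⟶ X} {g : X ⟶ N} {w : f ≫ g = 0}
  (h : (ShortComplex.mk f g w).ShortExact) (hX : V X)

/-- The coresolution `0 ⟶ M ⟶ X ⟶ Y⁰ ⟶ Y¹ ⟶ ⋯` spliced from an exact sequence
`0 ⟶ M ⟶ X ⟶ N ⟶ 0` and a coresolution `Y` of `N`. -/
noncomputable def cons : Coresolution V M where
  complex := Y.complex.augment (g ≫ Y.ι) (by simp [Y.ι_d])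
  ι := f
  ι_d := by
    change f ≫ g ≫ Y.ι = 0
    rw [reassoc_of% w, zero_comp]
  mem
    | 0 => hX
    | n + 1 => Y.mem n
  exact := by
    obtain ⟨hι, hY⟩ := (acyclic_iff _).1 Y.exact
    have : Mono Y.ι := hι
    have : Epi g := h.epi_g
    refine (acyclic_iff _).2 ⟨h.mono_f, fun n => ?_⟩
    match n with
    | 0 => exact (exact_comp_mono_iff Y.ι w _).2 h.exact
    | 1 => exact (exact_epi_comp_iff g Y.ι_d _).2 (hY 0)
    | n + 2 => exact hY (n + 1)

variable {Y} in
lemma IsProper.cons (hY : Y.IsProper) (hf : ExtendsAlong V f) : (Y.cons h hX).IsProper := by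
  have : Epi g := h.epi_g
  obtain ⟨hι, hY₀, hY⟩ := Y.isProper_iff.1 hY
  refine (isProper_iff _).2 ⟨hf, fun W hW (b : X ⟶ W) hb => ?_, fun n W hW b hb => ?_⟩
  · obtain ⟨u, hu⟩ := hι W hW (h.exact.desc b hb)
    refine ⟨u, ?_⟩
    change (g ≫ Y.ι) ≫ u = b
    rw [Category.assoc, hu]
    exact h.exact.g_desc b hb
  · match n with
    | 0 =>
      have hb' : g ≫ Y.ι ≫ b = 0 := (Category.assoc g Y.ι b).symm.trans hb
      exact hY₀ W hW b ((cancel_epi g).1 (hb'.trans comp_zero.symm))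
    | n + 1 => exact hY n W hW b hb

end Cons

end Coresolution

section FiniteCoresolution

/-- The objects `M` that admit an exact sequence `0 ⟶ M ⟶ X⁰ ⟶ ⋯ ⟶ Xᵈ⁻¹ ⟶ B ⟶ 0` with all `Xⁱ`
in `V` and with `B` in `W`. -/
def finiteCoresolution (V W : ObjectProperty A) : ℕ → ObjectProperty A
  | 0 => W
  | d + 1 => fun M => ∃ M', finiteCoresolution V W d M' ∧ IsSyzygy V M M'

variable {V W : ObjectProperty A}

instance [W.IsClosedUnderIsomorphisms] (d : ℕ) :
    (finiteCoresolution V W d).IsClosedUnderIsomorphisms where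
  of_iso {_ _} e h :=
    match d, h with
    | 0, h => W.prop_of_iso e h
    | _ + 1, ⟨M', h', hM⟩ => ⟨M', h', hM.of_iso e (Iso.refl _)⟩

lemma Coresolution.finiteCoresolution_of_prop_cycles [W.IsClosedUnderIsomorphisms] {N : A}
    (Y : Coresolution V N) {d : ℕ} (h : W (Y.complex.cycles d)) : finiteCoresolution V W d N := by
  have hcycles (k n : ℕ) (hn : n + k = d) : finiteCoresolution V W k (Y.complex.cycles n) := by
    induction k generalizing n with
    | zero =>
      obtain rfl : n = d := hn
      exact h
    | succ k ih => exact ⟨_, ih (n + 1) (by omega), _, Y.mem n, .of_shortExact (Y.shortExact n)⟩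
  exact (finiteCoresolution V W d).prop_of_iso Y.isoCycles.symm (hcycles d 0 (Nat.zero_add d))

/-- The zero coresolution of a zero object. -/
noncomputable def zeroCoresolution {N : A} (hN : IsZero N) (hV : V N) : Coresolution V N where
  complex := { X := fun _ => N, d := fun _ _ => 0 }
  ι := 0
  ι_d := by simp
  mem _ := hV
  exact := (acyclic_iff _).2 ⟨⟨fun _ _ _ => hN.eq_of_tgt _ _⟩,
    fun n => match n with
      | 0 => ShortComplex.exact_of_isZero_X₂ _ hN
      | _ + 1 => ShortComplex.exact_of_isZero_X₂ _ hN⟩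

lemma exists_coresolution_of_finiteCoresolution [V.ContainsZero] (d : ℕ) {M : A}
    (h : finiteCoresolution V V d M) : ∃ Y : Coresolution V M, Y.length ≤ d := by
  simp only [Coresolution.length_le_iff]
  induction d generalizing M with
  | zero =>
    obtain ⟨Z, hZ, hVZ⟩ := V.exists_prop_of_containsZero
    obtain ⟨f, g, w, e⟩ := isExtension_id M hZ
    exact ⟨(zeroCoresolution hZ hVZ).cons e h, fun n hn => match n, hn with
      | _ + 1, _ => hZ⟩
  | succ d ih =>
    obtain ⟨M', h', X, hX, f, g, w, e⟩ := h
    obtain ⟨Y, hY⟩ := ih h'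
    exact ⟨Y.cons e hX, fun n hn => match n, hn with
      | n + 1, hn => hY n (by omega)⟩

lemma exists_finiteCoresolution_of_injDim_lt_top [V.IsClosedUnderIsomorphisms] {M : A}
    (h : injDim V M < ⊤) : ∃ d, finiteCoresolution V V d M := by
  obtain ⟨Y, hY⟩ := iInf_lt_iff.1 h
  obtain ⟨d, hd⟩ := ENat.ne_top_iff_exists.1 hY.ne
  have hzero : IsZero (Y.complex.cycles (d + 1)) :=
    IsZero.of_mono (Y.complex.iCycles (d + 1)) (Y.length_le_iff.1 hd.ge _ d.lt_succ_self)
  have : IsIso (Y.complex.iCycles d) := (Y.shortExact d).isIso_f_iff.2 hzero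
  exact ⟨d, Y.finiteCoresolution_of_prop_cycles
    (V.prop_of_iso (asIso (Y.complex.iCycles d)).symm (Y.mem d))⟩

lemma injDim_lt_top_of_finiteCoresolution [V.ContainsZero] {d : ℕ} {M : A}
    (h : finiteCoresolution V V d M) : injDim V M < ⊤ := by
  obtain ⟨Y, hY⟩ := exists_coresolution_of_finiteCoresolution d h
  exact ((iInf_le _ Y).trans hY).trans_lt (ENat.natCast_lt_top d)

lemma IsExtension.exists_comp {M G M' X G' : A} (h : IsExtension M G M')
    (h' : IsExtension G X G') : ∃ Q, IsExtension M X Q ∧ IsExtension M' Q G' := by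
  obtain ⟨Z, hZ⟩ := HasZeroObject.zero (C := A)
  obtain ⟨f, g, w, h⟩ := h
  obtain ⟨f', g', w', h'⟩ := h'
  have hM : (ShortComplex.mk (𝟙 M) (0 : M ⟶ Z) comp_zero).ShortExact :=
    { exact := (ShortComplex.exact_iff_epi _ rfl).2 (inferInstanceAs (Epi (𝟙 M)))
      mono_f := inferInstanceAs (Mono (𝟙 M))
      epi_g := ⟨fun _ _ _ => hZ.eq_of_src _ _⟩ }
  have hG' : (ShortComplex.mk (0 : Z ⟶ G') (𝟙 G') zero_comp).ShortExact :=
    { exact := (ShortComplex.exact_iff_mono _ rfl).2 (inferInstanceAs (Mono (𝟙 G')))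
      mono_f := ⟨fun _ _ _ => hZ.eq_of_tgt _ _⟩
      epi_g := inferInstanceAs (Epi (𝟙 G')) }
  exact exists_cokernel_extension hM h'
    { τ₁ := f, τ₂ := f ≫ f', τ₃ := 0, comm₂₃ := by simp [w'] } h hG'

variable [HasExt.{w} A]

lemma leftPerp_of_finiteCoresolution (hV : V ≤ leftPerp.{w} V) (hW : W ≤ leftPerp.{w} V) (d : ℕ)
    {M : A} (h : finiteCoresolution V W d M) : leftPerp.{w} V M := by
  induction d generalizing M with
  | zero => exact hW _ h
  | succ d ih =>
    obtain ⟨M', h', X, hX, f, g, w, e⟩ := h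
    exact leftPerp.X₁ e (hV _ hX) (ih h')

variable [V.IsClosedUnderBinaryProducts] (hV : V ≤ leftPerp.{w} V)

include hV

lemma finiteCoresolution_gorenstein_X₂ (d : ℕ) {X₁ X₂ X₃ : A} (h : IsExtension X₁ X₂ X₃)
    (h₁ : finiteCoresolution V (gorenstein V) d X₁) (h₃ : gorenstein V X₃) :
    finiteCoresolution V (gorenstein V) d X₂ := by
  induction d generalizing X₁ X₂ X₃ with
  | zero =>
    have := gorenstein_isClosedUnderExtensions hV
    obtain ⟨_, _, _, h⟩ := h
    exact (gorenstein V).prop_X₂_of_shortExact h h₁ h₃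
  | succ d ih =>
    obtain ⟨Y₁, hY₁, e₁⟩ := h₁
    obtain ⟨Y₃, hY₃, e₃⟩ := h₃.exists_cosyzygy
    obtain ⟨Y₂, e₂, e⟩ := h.exists_cosyzygy e₁ e₃ (gorenstein_le_leftPerp hV _ h₃)
    exact ⟨Y₂, ih e hY₁ hY₃, e₂⟩

lemma finiteCoresolution_of_finiteCoresolution_gorenstein (d : ℕ) {M : A}
    (h : finiteCoresolution (gorenstein V) (gorenstein V) d M) :
    finiteCoresolution V (gorenstein V) d M := by
  induction d generalizing M with
  | zero => exact h
  | succ d ih =>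
    obtain ⟨M', h', G, hG, e⟩ := h
    obtain ⟨G', hG', X, hX, e'⟩ := hG.exists_cosyzygy
    obtain ⟨Q, hQ, hQ'⟩ := e.exists_comp e'
    exact ⟨Q, finiteCoresolution_gorenstein_X₂ hV d hQ' (ih h') hG', X, hX, hQ⟩

end FiniteCoresolution

section TateExistence

variable {V : ObjectProperty A} {N : A}

/-- A coresolution, extended by zero to all degrees, is unchanged in degrees `n ≥ 0`. -/
noncomputable def Coresolution.extendXIso (Y : Coresolution V N) (n : ℕ) :
    (Y.complex.extend ComplexShape.embeddingUpNat).X n ≅ Y.complex.X n :=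
  Y.complex.extendXIso ComplexShape.embeddingUpNat (i := n) (i' := n) rfl

lemma Coresolution.extendXIso_hom_d (Y : Coresolution V N) (n : ℕ) :
    (Y.extendXIso n).hom ≫ Y.complex.d n (n + 1) =
      (Y.complex.extend ComplexShape.embeddingUpNat).d n (n + 1 : ℕ) ≫
        (Y.extendXIso (n + 1)).hom := by
  rw [Y.complex.extend_d_eq ComplexShape.embeddingUpNat (i := n) (j := n + 1) (i' := n)
    (j' := (n + 1 : ℕ)) rfl rfl]
  simp [extendXIso]

namespace TateCoresolution

section OfHom

variable {Y : Coresolution V N} (hY : Y.IsProper) {S : CochainComplex A ℤ}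
  (hS : IsTotallyAcyclic V S) (β : ∀ n : ℕ, Y.complex.X n ⟶ S.X n)
  (hβ : ∀ n : ℕ, β n ≫ S.d n (n + 1 : ℕ) = Y.complex.d n (n + 1) ≫ β (n + 1))
  (hiso : ∃ n₀, ∀ n, n₀ ≤ n → IsIso (β n))

/-- The Tate coresolution given by a comparison morphism in degrees `n ≥ 0`. -/
noncomputable def ofHom : TateCoresolution V N where
  Y := Y
  proper := hY
  S := S
  totallyAcyclic := hS
  β :=
    { f := fun
        | .ofNat n => (Y.extendXIso n).hom ≫ β n
        | .negSucc n => 0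
      comm' := by
        rintro (n | n) m rfl
        · change ((Y.extendXIso n).hom ≫ β n) ≫ S.d n (n + 1 : ℕ) =
            (Y.complex.extend ComplexShape.embeddingUpNat).d n (n + 1 : ℕ) ≫
              (Y.extendXIso (n + 1)).hom ≫ β (n + 1)
          rw [← reassoc_of% Y.extendXIso_hom_d n, Category.assoc, hβ]
        · exact (Y.complex.isZero_extend_X ComplexShape.embeddingUpNat _
            (fun i (h : Int.ofNat i = Int.negSucc n) => by cases h)).eq_of_src _ _ }
  isIso_β := by
    obtain ⟨n₀, hn₀⟩ := hiso
    refine ⟨n₀, fun n hn => ?_⟩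
    obtain ⟨n, rfl⟩ := Int.eq_ofNat_of_zero_le (le_trans (by simp) hn)
    have := hn₀ n (by simpa using hn)
    exact inferInstanceAs (IsIso ((Y.extendXIso n).hom ≫ β n))

end OfHom

variable (T : TateCoresolution V N)

/-- The comparison morphism in degree `n ≥ 0`. -/
noncomputable def hom (n : ℕ) : T.Y.complex.X n ⟶ T.S.X n :=
  (T.Y.extendXIso n).inv ≫ T.β.f n

lemma hom_d (n : ℕ) :
    T.hom n ≫ T.S.d n (n + 1 : ℕ) = T.Y.complex.d n (n + 1) ≫ T.hom (n + 1) := by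
  rw [← cancel_epi (T.Y.extendXIso n).hom, reassoc_of% T.Y.extendXIso_hom_d n]
  simp [hom]

lemma exists_isIso_hom : ∃ n₀, ∀ n, n₀ ≤ n → IsIso (T.hom n) := by
  obtain ⟨m, hm⟩ := T.isIso_β
  refine ⟨m.toNat, fun n hn => ?_⟩
  have := hm n (by omega)
  exact inferInstanceAs (IsIso ((T.Y.extendXIso n).inv ≫ T.β.f n))

end TateCoresolution

section NonnegativePart

variable {S : CochainComplex A ℤ} (hS : IsTotallyAcyclic V S) (e : N ≅ S.cycles 0)

/-- The part of a totally acyclic complex `S` in degrees `n ≥ 0`, as a coresolution of `Z⁰(S)`. -/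
noncomputable def IsTotallyAcyclic.coresolution : Coresolution V N where
  complex := S.restriction ComplexShape.embeddingUpNat
  ι := e.hom ≫ S.iCycles 0
  ι_d := by
    change (e.hom ≫ S.iCycles 0) ≫ S.d 0 1 = 0
    rw [Category.assoc, S.iCycles_d, comp_zero]
  mem n := hS.mem n
  exact := (acyclic_iff _).2 ⟨mono_comp e.hom (S.iCycles 0), fun
    | 0 => (exact_epi_comp_iff e.hom (S.iCycles_d 0 1) _).2
        (ShortComplex.exact_of_f_is_kernel _ (S.cyclesIsKernel 0 1 (by simp)))
    | n + 1 => (S.exactAt_iff' n (n + 1 : ℕ) (n + 2 : ℕ) (by simp) (by simp; omega)).1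
        (hS.exact _)⟩

lemma IsTotallyAcyclic.isProper_coresolution : (hS.coresolution e).IsProper := by
  refine (hS.coresolution e).isProper_iff.2 ⟨fun W hW a => ?_,
    fun W hW (b : S.X 0 ⟶ W) (hb : (e.hom ≫ S.iCycles 0) ≫ b = 0) => ?_, fun n W hW b hb => ?_⟩
  · obtain ⟨u, hu⟩ := hS.extendsAlong 0 W hW (e.inv ≫ a)
    refine ⟨u, ?_⟩
    change (e.hom ≫ S.iCycles 0) ≫ u = a
    rw [Category.assoc, hu, e.hom_inv_id_assoc]
  · refine (exactAt_homTo_iff S W (i := -1) (j := 0) (k := 1) (by simp) (by simp)).1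
      (hS.homTo_exact W hW 0) b ?_
    have hb' : S.iCycles 0 ≫ b = 0 := by simpa using hb
    rw [← S.toCycles_i, Category.assoc, hb', comp_zero]
  · exact (exactAt_homTo_iff S W (i := n) (j := (n + 1 : ℕ)) (k := (n + 2 : ℕ))
      (by simp) (by simp; omega)).1 (hS.homTo_exact W hW _) b hb

lemma gorenstein.hasTateCoresolution {G : A} (hG : gorenstein V G) : HasTateCoresolution V G := by
  obtain ⟨S, hS, ⟨e⟩⟩ := hG.exists_iso_cycles
  exact ⟨.ofHom (hS.isProper_coresolution e) hS (fun _ => 𝟙 _)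
    (fun _ => (Category.id_comp _).trans (Category.comp_id _).symm)
    ⟨0, fun _ _ => inferInstanceAs (IsIso (𝟙 _))⟩⟩

end NonnegativePart

lemma TateCoresolution.cons (T : TateCoresolution V N) {M X : A} {f : M ⟶ X} {g : X ⟶ N}
    {w : f ≫ g = 0} (h : (ShortComplex.mk f g w).ShortExact) (hX : V X) (hf : ExtendsAlong V f) :
    HasTateCoresolution V M := by
  obtain ⟨b, hb⟩ := (exactAt_homFrom_iff T.S X (i := (0 : ℕ) + -1) (j := (0 : ℕ)) (k := (1 : ℕ))
    (by simp) (by simp)).1 (T.totallyAcyclic.homFrom_exact X hX 0) ((g ≫ T.Y.ι) ≫ T.hom 0) (by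
      rw [Category.assoc, Category.assoc, T.hom_d 0, reassoc_of% T.Y.ι_d, zero_comp, comp_zero])
  let e (n : ℕ) : T.S.X n ≅ T.S.X ((n + 1 : ℕ) + -1) := T.S.XIsoOfEq (by push_cast; ring)
  refine ⟨.ofHom (T.proper.cons h hX hf) (T.totallyAcyclic.reindex (-1)) (fun
    | 0 => b
    | n + 1 => T.hom n ≫ (e n).hom) (fun
    | 0 => ?_
    | n + 1 => ?_) ?_⟩
  · change b ≫ T.S.d _ _ = (g ≫ T.Y.ι) ≫ T.hom 0 ≫ (e 0).hom
    rw [← Category.assoc (g ≫ T.Y.ι), ← hb, Category.assoc, T.S.d_comp_XIsoOfEq_hom]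
  · change (T.hom n ≫ (e n).hom) ≫ T.S.d _ _ = T.Y.complex.d n (n + 1) ≫ T.hom (n + 1) ≫ (e _).hom
    rw [← reassoc_of% T.hom_d n, Category.assoc, T.S.XIsoOfEq_hom_comp_d, T.S.d_comp_XIsoOfEq_hom]
  · obtain ⟨n₀, hn₀⟩ := T.exists_isIso_hom
    refine ⟨n₀ + 1, fun
      | n + 1, hn => ?_⟩
    have := hn₀ n (by omega)
    exact inferInstanceAs (IsIso (T.hom n ≫ (e n).hom))

variable [HasExt.{w} A] (hV : V ≤ leftPerp.{w} V)

include hV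

lemma hasTateCoresolution_of_finiteCoresolution (d : ℕ) {M : A}
    (h : finiteCoresolution V (gorenstein V) d M) : HasTateCoresolution V M := by
  induction d generalizing M with
  | zero => exact gorenstein.hasTateCoresolution h
  | succ d ih =>
    obtain ⟨M', h', X, hX, f, g, w, e⟩ := h
    obtain ⟨T⟩ := ih h'
    exact T.cons e hX
      ((leftPerp_of_finiteCoresolution hV (gorenstein_le_leftPerp hV) d h').extendsAlong e)

lemma hasTateCoresolution_of_injDim_gorenstein_lt_top [V.IsClosedUnderBinaryProducts] {M : A}
    (hM : injDim (gorenstein V) M < ⊤) : HasTateCoresolution V M := by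
  obtain ⟨d, h⟩ := exists_finiteCoresolution_of_injDim_lt_top hM
  exact hasTateCoresolution_of_finiteCoresolution hV d
    (finiteCoresolution_of_finiteCoresolution_gorenstein hV d h)

end TateExistence
section TateVanishing

variable {V : ObjectProperty A}

namespace TateCoresolution

variable {N : A} (T : TateCoresolution V N)

/-- The comparison morphism on cycles in degree `n ≥ 0`. -/
noncomputable def cyclesHom (n : ℕ) : T.Y.complex.cycles n ⟶ T.S.cycles n :=
  T.S.liftCycles (T.Y.complex.iCycles n ≫ T.hom n) (n + 1 : ℕ) (by simp)
    (by rw [Category.assoc, T.hom_d, T.Y.complex.iCycles_d_assoc, zero_comp])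

@[simp]
lemma cyclesHom_iCycles (n : ℕ) :
    T.cyclesHom n ≫ T.S.iCycles n = T.Y.complex.iCycles n ≫ T.hom n := by
  simp [cyclesHom]

/-- The comparison morphism between the sequences `0 ⟶ Zⁿ ⟶ Xⁿ ⟶ Zⁿ⁺¹ ⟶ 0`. -/
noncomputable def cyclesSequenceHom (n : ℕ) :
    cyclesSequence T.Y.complex n (n + 1) ⟶ cyclesSequence T.S n (n + 1 : ℕ) where
  τ₁ := T.cyclesHom n
  τ₂ := T.hom n
  τ₃ := T.cyclesHom (n + 1)
  comm₁₂ := T.cyclesHom_iCycles n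
  comm₂₃ := by
    change T.hom n ≫ T.S.toCycles n (n + 1 : ℕ) =
      T.Y.complex.toCycles n (n + 1) ≫ T.cyclesHom (n + 1)
    rw [← cancel_mono (T.S.iCycles (n + 1 : ℕ)), Category.assoc, Category.assoc,
      T.S.toCycles_i, T.hom_d, T.cyclesHom_iCycles, ← Category.assoc, T.Y.complex.toCycles_i]

lemma exists_isIso_cyclesHom : ∃ n, IsIso (T.cyclesHom n) := by
  obtain ⟨n, hn⟩ := T.exists_isIso_hom
  have := hn n le_rfl
  have := hn (n + 1) n.le_succ
  refine ⟨n, T.Y.complex.liftCycles (T.S.iCycles n ≫ inv (T.hom n)) (n + 1) (by simp) ?_, ?_, ?_⟩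
  · rw [← cancel_mono (T.hom (n + 1)), Category.assoc, Category.assoc, ← T.hom_d]
    simp
  · simp [← cancel_mono (T.Y.complex.iCycles n), reassoc_of% T.cyclesHom_iCycles n]
  · simp [← cancel_mono (T.S.iCycles n)]

end TateCoresolution

namespace IsTotallyAcyclic

variable {S : CochainComplex A ℤ} (hS : IsTotallyAcyclic V S)

include hS

lemma isZero_homology_iff (n : ℤ) (L : A) :
    IsZero ((homFrom L S).homology n) ↔ ∀ f : L ⟶ S.cycles n, FactorsThrough V f := by
  have hn : n - 1 + 1 = n := sub_add_cancel n 1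
  rw [← HomologicalComplex.exactAt_iff_isZero_homology,
    exactAt_homFrom_iff S L (i := n - 1) (k := n + 1) (by simp) (by simp)]
  refine ⟨fun h f => ?_, fun h f hf => ?_⟩
  · obtain ⟨g, hg⟩ := h (f ≫ S.iCycles n) (by simp)
    exact ⟨_, g, S.toCycles (n - 1) n, hS.mem _, by
      rw [← cancel_mono (S.iCycles n), Category.assoc, S.toCycles_i, hg]⟩
  · obtain ⟨W, a, b, hW, hab⟩ := h (S.liftCycles f (n + 1) (by simp) hf)
    obtain ⟨u, rfl⟩ := hS.liftsAlong hn W hW b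
    exact ⟨a ≫ u, by rw [← S.toCycles_i, Category.assoc, reassoc_of% hab, S.liftCycles_i]⟩

lemma factorsThrough_id_iff (n m : ℤ) :
    FactorsThrough V (𝟙 (S.cycles n)) ↔ FactorsThrough V (𝟙 (S.cycles m)) := by
  have key (k : ℤ) :
      FactorsThrough V (𝟙 (S.cycles k)) ↔ FactorsThrough V (𝟙 (S.cycles (k + 1))) :=
    have h := hS.shortExact (rfl : k + 1 = k + 1)
    ⟨fun h' => FactorsThrough.τ₃ h (𝟙 (cyclesSequence S k (k + 1))) (hS.mem k)
      (hS.extendsAlong k) h', fun h' => FactorsThrough.τ₁ h (𝟙 (cyclesSequence S k (k + 1)))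
      (hS.mem k) (hS.liftsAlong rfl) h'⟩
  induction m using Int.inductionOn' (b := n) with
  | zero => rfl
  | succ k _ ih => exact ih.trans (key k)
  | pred k _ ih => exact ih.trans (by rw [key (k - 1), sub_add_cancel])

lemma factorsThrough_of_finiteCoresolution [HasExt.{w} A] (hV : V ≤ leftPerp.{w} V) (d : ℕ)
    {M : A} (h : finiteCoresolution V V d M) (n : ℤ) (f : M ⟶ S.cycles n) :
    FactorsThrough V f := by
  induction d generalizing M n with
  | zero => exact ⟨M, 𝟙 M, f, h, Category.id_comp f⟩
  | succ d ih =>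
    obtain ⟨M', h', X, hX, i, p, w, e⟩ := h
    obtain ⟨φ, rfl⟩ := ((leftPerp_of_finiteCoresolution hV hV d h').extendsAlong e).exists_hom e
      (T := cyclesSequence S n (n + 1)) (hS.mem n) f
    exact FactorsThrough.τ₁ (hS.shortExact rfl) φ hX (hS.liftsAlong rfl) (ih h' (n + 1) φ.τ₃)

variable [V.ContainsZero] {a : ℤ} (T : TateCoresolution V (S.cycles a))

lemma isStableRetract_cycles_coresolution (n : ℕ) :
    IsStableRetract V (S.cycles (a + n)) (T.Y.complex.cycles n) := by
  induction n with
  | zero =>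
    rw [Nat.cast_zero, add_zero]
    exact .of_iso T.Y.isoCycles
  | succ n ih =>
    exact ih.X₃ (hS.shortExact (by push_cast; ring)) (T.Y.shortExact n) (hS.mem _) (T.Y.mem n)
      (hS.extendsAlong _) (T.proper.extendsAlong n)

lemma isStableRetract_cycles (n : ℤ) : IsStableRetract V (S.cycles (a + n)) (T.S.cycles n) := by
  obtain ⟨n₀, hn₀⟩ := T.exists_isIso_cyclesHom
  induction n using Int.inductionOn' (b := (n₀ : ℤ)) with
  | zero =>
    exact (hS.isStableRetract_cycles_coresolution T n₀).of_iso_right (asIso (T.cyclesHom n₀))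
  | succ k _ ih =>
    exact ih.X₃ (hS.shortExact (by ring)) (T.totallyAcyclic.shortExact rfl) (hS.mem _)
      (T.totallyAcyclic.mem _) (hS.extendsAlong _) (T.totallyAcyclic.extendsAlong _)
  | pred k _ ih =>
    exact ih.X₁ (hS.shortExact (by ring)) (T.totallyAcyclic.shortExact (by ring)) (hS.mem _)
      (T.totallyAcyclic.mem _) (hS.liftsAlong (by ring)) (T.totallyAcyclic.liftsAlong (by ring))

end IsTotallyAcyclic

lemma isZero_tateExt_iff (n : ℤ) (M N : A) (hN : HasTateCoresolution V N) :
    IsZero (tateExt V n M N hN) ↔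
      ∀ f : M ⟶ (Classical.choice hN).S.cycles n, FactorsThrough V f :=
  (Classical.choice hN).totallyAcyclic.isZero_homology_iff n M

namespace TateCoresolution

variable {M : A} (T : TateCoresolution V M)

lemma finiteCoresolution_of_factorsThrough_id [V.IsStableUnderRetracts] {n : ℤ}
    (h : FactorsThrough V (𝟙 (T.S.cycles n))) : ∃ d, finiteCoresolution V V d M := by
  obtain ⟨d, hd⟩ := T.exists_isIso_cyclesHom
  rw [T.totallyAcyclic.factorsThrough_id_iff n d] at h
  exact ⟨d, T.Y.finiteCoresolution_of_prop_cycles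
    (V.prop_of_iso (asIso (T.cyclesHom d)).symm h.prop)⟩

lemma factorsThrough_id_of_factorsThrough
    (h : ∀ f : M ⟶ T.S.cycles 0, FactorsThrough V f) (n : ℤ) :
    FactorsThrough V (𝟙 (T.S.cycles n)) := by
  have hcycles (n : ℕ) : FactorsThrough V (T.cyclesHom n) := by
    induction n with
    | zero => simpa using (h (T.Y.isoCycles.hom ≫ T.cyclesHom 0)).comp_left T.Y.isoCycles.inv
    | succ n ih =>
      exact FactorsThrough.τ₃ (T.Y.shortExact n) (T.cyclesSequenceHom n)
        (T.totallyAcyclic.mem _) (T.proper.extendsAlong n) ih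
  obtain ⟨d, hd⟩ := T.exists_isIso_cyclesHom
  rw [T.totallyAcyclic.factorsThrough_id_iff n d, ← IsIso.inv_hom_id (T.cyclesHom d)]
  exact (hcycles d).comp_left _

end TateCoresolution

end TateVanishing

end Abelian

section TensorEvaluation

open TensorProduct

variable {R : Type*} [CommRing R] (C : Type*) (I : Type w) (K P : Type*)
  [AddCommGroup C] [Module R C] [AddCommGroup I] [Module R I] [AddCommGroup K] [Module R K]
  [AddCommGroup P] [Module R P]

/-- The tensor evaluation morphism `K ⊗ Hom(C, I) ⟶ Hom(Hom(K, C), I)`. -/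
noncomputable def tensorEval : K ⊗[R] (C →ₗ[R] I) →ₗ[R] ((K →ₗ[R] C) →ₗ[R] I) :=
  TensorProduct.lift
    ((LinearMap.llcomp R (K →ₗ[R] C) C I).flip.comp (LinearMap.id (R := R) (M := K →ₗ[R] C)).flip)

@[simp]
lemma tensorEval_tmul (k : K) (f : C →ₗ[R] I) (g : K →ₗ[R] C) :
    tensorEval C I K (k ⊗ₜ f) g = f (g k) := rfl

variable {K P} in
lemma tensorEval_rTensor (a : K →ₗ[R] P) (x : K ⊗[R] (C →ₗ[R] I)) :
    tensorEval C I P (a.rTensor _ x) = LinearMap.lcomp R I (LinearMap.lcomp R C a)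
      (tensorEval C I K x) := by
  induction x with
  | zero => simp only [map_zero]
  | add x y hx hy => simp only [map_add, hx, hy]
  | tmul k f => ext g; simp

lemma tensorEval_bijective_of_free [Module.Free R P] [Module.Finite R P] :
    Function.Bijective (tensorEval (R := R) C I P) := by
  let b := Module.Free.chooseBasis R P
  let ψ : ((P →ₗ[R] C) →ₗ[R] I) →ₗ[R] P ⊗[R] (C →ₗ[R] I) :=
    ∑ i, TensorProduct.mk R P (C →ₗ[R] I) (b i) ∘ₗ
      LinearMap.lcomp R I (LinearMap.smulRightₗ (b.coord i))
  have hψ : ψ ∘ₗ tensorEval C I P = LinearMap.id := TensorProduct.ext' fun p f => by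
    have h (i) : tensorEval C I P (p ⊗ₜ f) ∘ₗ LinearMap.smulRightₗ (b.coord i) =
        b.coord i p • f := by ext c; simp
    simp only [ψ, LinearMap.comp_apply, LinearMap.sum_apply, LinearMap.lcomp_apply', h,
      TensorProduct.mk_apply, TensorProduct.tmul_smul, TensorProduct.smul_tmul',
      ← TensorProduct.sum_tmul, Module.Basis.coord_apply, b.sum_repr, LinearMap.id_apply]
  have hψ' : tensorEval C I P ∘ₗ ψ = LinearMap.id := by
    ext φ g
    simp only [ψ, LinearMap.comp_apply, LinearMap.sum_apply, map_sum, LinearMap.lcomp_apply',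
      TensorProduct.mk_apply, tensorEval_tmul, LinearMap.id_apply]
    rw [← map_sum]
    exact congrArg φ (b.ext fun j => by simp [Finsupp.single_apply, ite_smul])
  exact Function.bijective_iff_has_inverse.2
    ⟨ψ, LinearMap.congr_fun hψ, LinearMap.congr_fun hψ'⟩

variable {I}

lemma exact_lcomp_of_injective [Small.{w} R] [Module.Injective R I] {X Y Z : Type*}
    [AddCommGroup X] [Module R X] [AddCommGroup Y] [Module R Y] [AddCommGroup Z] [Module R Z]
    {f : X →ₗ[R] Y} {g : Y →ₗ[R] Z} (hfg : Function.Exact f g) :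
    Function.Exact (LinearMap.lcomp R I g) (LinearMap.lcomp R I f) := by
  intro φ
  constructor
  · intro hφ
    have hfg' : Function.Exact f g.rangeRestrict := fun y => by
      rw [← hfg y, ← LinearMap.codRestrict_apply (LinearMap.range g) g y]
      exact Submodule.coe_eq_zero.symm
    obtain ⟨ψ, rfl⟩ :=
      (LinearMap.exact_lcomp_of_exact_of_surjective I hfg' g.surjective_rangeRestrict φ).1 hφ
    obtain ⟨χ, rfl⟩ := Module.Injective.extension_property R I _ _ (LinearMap.range g).subtype
      (Submodule.subtype_injective _) ψ
    exact ⟨χ, rfl⟩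
  · rintro ⟨ψ, rfl⟩
    ext x
    simp [hfg.apply_apply_eq_zero]

variable {K P} {L : Type*} [AddCommGroup L] [Module R L]

lemma tensorEval_bijective_of_exact [Small.{w} R] [Module.Injective R I]
    {a : L →ₗ[R] P} {b : P →ₗ[R] K} (hab : Function.Exact a b) (hb : Function.Surjective b)
    (hL : Function.Surjective (tensorEval (R := R) C I L))
    (hP : Function.Bijective (tensorEval (R := R) C I P)) :
    Function.Bijective (tensorEval (R := R) C I K) := by
  have hab' := LinearMap.exact_lcomp_of_exact_of_surjective C hab hb
  constructor
  · rw [injective_iff_map_eq_zero]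
    intro x hx
    obtain ⟨y, rfl⟩ := LinearMap.rTensor_surjective (C →ₗ[R] I) hb x
    rw [tensorEval_rTensor] at hx
    obtain ⟨φ, hφ⟩ := (exact_lcomp_of_injective hab' (tensorEval C I P y)).1 hx
    obtain ⟨z, rfl⟩ := hL φ
    rw [← tensorEval_rTensor] at hφ
    rw [← hP.1 hφ]
    exact (rTensor_exact (C →ₗ[R] I) hab hb).apply_apply_eq_zero z
  · intro φ
    obtain ⟨φ', rfl⟩ := Module.Injective.extension_property R I _ _ _
      (LinearMap.lcomp_injective_of_surjective b hb) φ
    obtain ⟨y, rfl⟩ := hP.2 φ'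
    exact ⟨b.rTensor _ y, tensorEval_rTensor C I b y⟩

variable {C}

lemma rTensor_hom_injective {a : K →ₗ[R] P} (ha : Function.Surjective (LinearMap.lcomp R C a))
    (hK : Function.Injective (tensorEval (R := R) C I K)) :
    Function.Injective (a.rTensor (C →ₗ[R] I)) := by
  rw [injective_iff_map_eq_zero]
  refine fun x hx => hK (LinearMap.ext fun f => ?_)
  obtain ⟨g, rfl⟩ := ha f
  have h := LinearMap.congr_fun (tensorEval_rTensor C I a x) g
  simpa [hx] using h.symm

end TensorEvaluation

section Syzygies

open Abelian TensorProduct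

/-- A sequence of short exact sequences `0 ⟶ syzygy (n + 1) ⟶ cover n ⟶ syzygy n ⟶ 0` with free
modules `cover n` of finite rank: a resolution of `syzygy 0` by such modules, cut into pieces. -/
structure SyzygySequence (R : Type u) [CommRing R] where
  syzygy : ℕ → ModuleCat.{u} R
  cover : ℕ → ModuleCat.{u} R
  ι (n : ℕ) : syzygy (n + 1) ⟶ cover n
  π (n : ℕ) : cover n ⟶ syzygy n
  ι_π (n : ℕ) : ι n ≫ π n = 0
  shortExact (n : ℕ) : (ShortComplex.mk (ι n) (π n) (ι_π n)).ShortExact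
  free_cover (n : ℕ) : Module.Free R (cover n)
  finite_cover (n : ℕ) : Module.Finite R (cover n)

attribute [instance] SyzygySequence.free_cover SyzygySequence.finite_cover

variable {R : Type u} [CommRing R]

lemma IsSemidualizing.exists_syzygySequence {C : ModuleCat.{u} R} (hC : IsSemidualizing C) :
    ∃ T : SyzygySequence R, T.syzygy 0 = C := by
  obtain ⟨P, π, w, hP, hac⟩ := hC.exists_resolution
  let Q := P.augment π w
  let K (n : ℕ) : ModuleCat.{u} R := Nat.casesOn n C fun n => Q.cycles (n + 1)
  have hQ (n : ℕ) : IsExtension (Q.cycles (n + 1)) (P.X n) (Q.cycles n) :=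
    .of_shortExact (shortExact_cyclesSequence (K := Q) (j := n + 1) (k := n) rfl (hac n))
  have e : Q.cycles 0 ≅ Q.X 0 := asIso (Q.iCycles 0)
  have hK (n : ℕ) : IsExtension (K (n + 1)) (P.X n) (K n) := by
    cases n with
    | zero => exact (hQ 0).of_iso (Iso.refl _) e
    | succ n => exact hQ (n + 1)
  choose f g w hS using hK
  exact ⟨⟨K, P.X, f, g, w, hS, fun n => (hP n).1, fun n => (hP n).2⟩, rfl⟩

namespace SyzygySequence

variable (T : SyzygySequence R) (n : ℕ)

lemma ι_injective : Function.Injective (T.ι n).hom :=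
  (T.shortExact n).moduleCat_injective_f

lemma π_surjective : Function.Surjective (T.π n).hom :=
  (T.shortExact n).moduleCat_surjective_g

lemma exact : Function.Exact (T.ι n).hom (T.π n).hom :=
  (ShortComplex.ShortExact.moduleCat_exact_iff_function_exact _).1 (T.shortExact n).exact

lemma tensorEval_bijective (C I : Type u) [AddCommGroup C] [Module R C] [AddCommGroup I]
    [Module R I] [Module.Injective R I] :
    Function.Bijective (tensorEval (R := R) C I (T.syzygy n)) := by
  have h : Function.Exact ((T.ι n).hom ∘ₗ (T.π (n + 1)).hom) (T.π n).hom :=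
    (Function.Surjective.comp_exact_iff_exact (T.π_surjective (n + 1))).2 (T.exact n)
  exact tensorEval_bijective_of_exact C h (T.π_surjective n)
    (tensorEval_bijective_of_free C I _).2 (tensorEval_bijective_of_free C I _)

variable {T}

lemma leftPerp_syzygy {V : ObjectProperty (ModuleCat.{u} R)}
    (h : leftPerp.{u} V (T.syzygy 0)) : leftPerp.{u} V (T.syzygy n) := by
  induction n with
  | zero => exact h
  | succ n ih =>
    have : Projective (T.cover n) := (IsProjective.iff_projective (R := R) _).1 inferInstance
    exact leftPerp.X₁ (T.shortExact n) (fun X _ i => Ext.subsingleton_of_projective _ X i) ih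

lemma rTensor_hom_ι_injective {C : ModuleCat.{u} R}
    (h : leftPerp.{u} (fun X => X = C) (T.syzygy 0)) (I : Type u) [AddCommGroup I] [Module R I]
    [Module.Injective R I] : Function.Injective ((T.ι n).hom.rTensor (C →ₗ[R] I)) := by
  refine rTensor_hom_injective (fun f => ?_) (T.tensorEval_bijective (n + 1) C I).1
  obtain ⟨g, hg⟩ :=
    leftPerp.extendsAlong (T.shortExact n) (leftPerp_syzygy n h) C rfl (ModuleCat.ofHom f)
  exact ⟨g.hom, congrArg ModuleCat.Hom.hom hg⟩

variable (T) in
/-- Injectivity of all the maps `syzygy (n + 1) ⊗ U ⟶ cover n ⊗ U`, that is, the vanishing of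
`Torᵢ(syzygy 0, U)` for `i ≥ 1`. -/
def IsTorAcyclic (U : ModuleCat.{u} R) : Prop :=
  ∀ n, Function.Injective ((T.ι n).hom.rTensor U)

lemma IsTorAcyclic.lTensor_syzygy_injective {S : ShortComplex (ModuleCat.{u} R)}
    (hS : S.ShortExact) (hU : T.IsTorAcyclic S.X₃) :
    Function.Injective (S.f.hom.lTensor (T.syzygy n)) :=
  lTensor_injective_of_exact_of_exact_of_rTensor_injective (T.exact n) (T.π_surjective n)
    ((ShortComplex.ShortExact.moduleCat_exact_iff_function_exact _).1 hS.exact)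
    hS.moduleCat_surjective_g (hU n)
    (Module.Flat.lTensor_preserves_injective_linearMap _ hS.moduleCat_injective_f)

lemma IsTorAcyclic.X₁ {S : ShortComplex (ModuleCat.{u} R)} (hS : S.ShortExact)
    [Module.Flat R S.X₂] (hU : T.IsTorAcyclic S.X₃) : T.IsTorAcyclic S.X₁ := fun n => by
  have h : Function.Injective ((T.ι n).hom.rTensor S.X₂ ∘ₗ S.f.hom.lTensor (T.syzygy (n + 1))) := by
    rw [LinearMap.coe_comp]
    exact (Module.Flat.rTensor_preserves_injective_linearMap _ (T.ι_injective n)).comp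
      (hU.lTensor_syzygy_injective (n + 1) hS)
  rw [LinearMap.rTensor_comp_lTensor, ← LinearMap.lTensor_comp_rTensor] at h
  exact Function.Injective.of_comp h

lemma IsTorAcyclic.exists_extension_hom {S : ShortComplex (ModuleCat.{u} R)} (hS : S.ShortExact)
    (hU : T.IsTorAcyclic S.X₃) {J : Type u} [AddCommGroup J] [Module R J] [Module.Injective R J]
    (φ : S.X₁ ⟶ ModuleCat.of R (T.syzygy 0 →ₗ[R] J)) : ∃ ψ, S.f ≫ ψ = φ := by
  obtain ⟨ψ, hψ⟩ := Module.Injective.extension_property R J _ _ (S.f.hom.lTensor (T.syzygy 0))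
    (hU.lTensor_syzygy_injective 0 hS) (TensorProduct.lift φ.hom.flip)
  refine ⟨ModuleCat.ofHom (TensorProduct.curry ψ).flip, ?_⟩
  ext x k
  exact LinearMap.congr_fun hψ (k ⊗ₜ x)

lemma IsTorAcyclic.subsingleton_ext_hom (J : ModuleCat.{u} R) [Module.Injective R J] (i : ℕ)
    {U : ModuleCat.{u} R} (hU : T.IsTorAcyclic U) :
    Subsingleton (Ext.{u} U (ModuleCat.of R (T.syzygy 0 →ₗ[R] J)) (i + 1)) := by
  induction i generalizing U with
  | zero =>
    obtain ⟨f, g, w, hS⟩ := isExtension_kernel (Projective.π U)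
    have := Ext.subsingleton_of_projective (Projective.over U)
      (ModuleCat.of R (T.syzygy 0 →ₗ[R] J)) 0
    exact subsingleton_ext_one_of_exists_extension hS (IsTorAcyclic.exists_extension_hom hS hU)
  | succ i ih =>
    obtain ⟨f, g, w, hS⟩ := isExtension_kernel (Projective.π U)
    have : Module.Projective R ↑(Projective.over U : ModuleCat.{u} R) :=
      (IsProjective.iff_projective (R := R) _).2
        (inferInstanceAs (Projective (Projective.over U)))
    have := ih (IsTorAcyclic.X₁ hS hU)
    have := Ext.subsingleton_of_projective (Projective.over U)
      (ModuleCat.of R (T.syzygy 0 →ₗ[R] J)) (i + 1)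
    exact subsingleton_ext_X₃_left hS _ (Nat.add_comm 1 (i + 1))

end SyzygySequence

end Syzygies

section CInjective

open Abelian TensorProduct

lemma applyₗ_id_bijective {R C : Type*} [CommRing R] [AddCommGroup C] [Module R C]
    (h : Function.Bijective (LinearMap.lsmul R C)) (I : Type*) [AddCommGroup I] [Module R I] :
    Function.Bijective (LinearMap.applyₗ LinearMap.id : ((C →ₗ[R] C) →ₗ[R] I) →ₗ[R] I) := by
  let e : ((C →ₗ[R] C) →ₗ[R] I) ≃ₗ[R] I :=
    ((LinearEquiv.ofBijective _ h).symm.congrLeft I R).trans (LinearMap.ringLmapEquivSelf R R I)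
  convert e.bijective using 1
  ext φ
  exact congrArg φ (LinearMap.ext fun c => (one_smul R c).symm)

lemma flip_mk_bijective_of_leftInverse {R C Z Z' : Type*} [CommRing R] [AddCommGroup C]
    [Module R C] [AddCommGroup Z] [Module R Z] [AddCommGroup Z'] [Module R Z'] {i : Z →ₗ[R] Z'}
    {p : Z' →ₗ[R] Z} (h : p ∘ₗ i = LinearMap.id)
    (hZ' : Function.Bijective (TensorProduct.mk R C Z').flip) :
    Function.Bijective (TensorProduct.mk R C Z).flip := by
  refine ⟨fun z₁ z₂ hz => ?_, fun φ => ?_⟩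
  · have hi : Function.Injective i := Function.LeftInverse.injective (LinearMap.congr_fun h)
    exact hi (hZ'.1 (congrArg (fun φ => i.lTensor C ∘ₗ φ) hz))
  · obtain ⟨z', hz'⟩ := hZ'.2 (i.lTensor C ∘ₗ φ)
    refine ⟨p z', ?_⟩
    calc (TensorProduct.mk R C Z).flip (p z')
        = p.lTensor C ∘ₗ (TensorProduct.mk R C Z').flip z' := rfl
      _ = φ := by
        rw [hz', ← LinearMap.comp_assoc, ← LinearMap.lTensor_comp, h, LinearMap.lTensor_id,
          LinearMap.id_comp]

variable {R : Type u} [CommRing R] {C : ModuleCat.{u} R}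

lemma IsSemidualizing.exists_tensor_hom_equiv (hC : IsSemidualizing C) (I : Type u)
    [AddCommGroup I] [Module R I] [Module.Injective R I] :
    ∃ ε : C ⊗[R] (C →ₗ[R] I) ≃ₗ[R] I, ∀ c f, ε (c ⊗ₜ f) = f c := by
  obtain ⟨T, rfl⟩ := hC.exists_syzygySequence
  exact ⟨.ofBijective (LinearMap.applyₗ LinearMap.id ∘ₗ tensorEval _ I _)
    ((applyₗ_id_bijective hC.homothety_bijective I).comp (T.tensorEval_bijective 0 _ I)),
    fun _ _ => rfl⟩

lemma IsSemidualizing.cInjective_iff (hC : IsSemidualizing C) (X : ModuleCat.{u} R) :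
    cInjective C X ↔ Injective (ModuleCat.of R (C ⊗[R] X)) ∧
      Function.Bijective (TensorProduct.mk R C X).flip := by
  constructor
  · rintro ⟨I, hI, ⟨e⟩⟩
    have := Module.injective_module_of_injective_object R I
    obtain ⟨ε, hε⟩ := hC.exists_tensor_hom_equiv I
    have hbij : Function.Bijective (TensorProduct.mk R C (C →ₗ[R] I)).flip := by
      rw [← (LinearEquiv.congrRight ε (M := C)).bijective.of_comp_iff']
      convert Function.bijective_id using 1
      ext f c
      exact hε c f
    refine ⟨.of_iso (e.toLinearEquiv.lTensor C ≪≫ₗ ε).toModuleIso.symm hI,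
      flip_mk_bijective_of_leftInverse (i := e.hom.hom) (p := e.inv.hom) ?_ hbij⟩
    exact congrArg ModuleCat.Hom.hom e.hom_inv_id
  · rintro ⟨hI, h⟩
    exact ⟨_, hI, ⟨(LinearEquiv.ofBijective _ h).toModuleIso⟩⟩

lemma IsSemidualizing.cInjective_isStableUnderRetracts (hC : IsSemidualizing C) :
    (cInjective C).IsStableUnderRetracts where
  of_retract {X Y} r hY := by
    rw [hC.cInjective_iff] at hY ⊢
    have : Injective ((MonoidalCategory.tensorLeft C).obj Y) := hY.1
    exact ⟨(r.map (MonoidalCategory.tensorLeft C)).injective,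
      flip_mk_bijective_of_leftInverse (congrArg ModuleCat.Hom.hom r.retract) hY.2⟩

instance : (cInjective C).ContainsZero where
  exists_zero := by
    have hZ := ModuleCat.isZero_of_subsingleton (ModuleCat.of R PUnit.{u + 1})
    exact ⟨_, ModuleCat.isZero_of_subsingleton (ModuleCat.of R (C →ₗ[R] PUnit.{u + 1})),
      _, hZ.injective, ⟨Iso.refl _⟩⟩

instance : (cInjective C).IsClosedUnderBinaryProducts where
  limitsOfShape_le := by
    rintro X ⟨p⟩
    obtain ⟨I, hI, ⟨e⟩⟩ := p.prop_diag_obj (.mk .left)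
    obtain ⟨J, hJ, ⟨e'⟩⟩ := p.prop_diag_obj (.mk .right)
    have hX := p.isLimit.conePointsIsoOfNatIso (ModuleCat.binaryProductLimitCone _ _).isLimit
      (diagramIsoPair p.diag)
    exact ⟨ModuleCat.of R (I × J), .of_iso (ModuleCat.biprodIsoProd I J) inferInstance,
      ⟨hX ≪≫ (e.toLinearEquiv.prodCongr e'.toLinearEquiv ≪≫ₗ LinearMap.prodEquiv R).toModuleIso⟩⟩

lemma IsSemidualizing.cInjective_le_leftPerp (hC : IsSemidualizing C) :
    cInjective C ≤ leftPerp.{u} (cInjective C) := by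
  obtain ⟨T, rfl⟩ := hC.exists_syzygySequence
  rintro X ⟨I, hI, ⟨e⟩⟩
  refine (leftPerp _).prop_of_iso e.symm ?_
  rintro Y ⟨J, hJ, ⟨e'⟩⟩ i
  have := Module.injective_module_of_injective_object R I
  have := Module.injective_module_of_injective_object R J
  have hT : leftPerp.{u} (fun X => X = T.syzygy 0) (T.syzygy 0) := by
    rintro _ rfl i
    exact hC.ext_eq_zero _ (Nat.le_add_left 1 i)
  have hacyclic : T.IsTorAcyclic (ModuleCat.of R (T.syzygy 0 →ₗ[R] I)) := fun n =>
    SyzygySequence.rTensor_hom_ι_injective n hT I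
  refine (rightPerp (fun Z => Z = _)).prop_of_iso e'.symm ?_ _ rfl i
  rintro _ rfl i
  exact hacyclic.subsingleton_ext_hom J i

end CInjective

end RelativeTate

open RelativeTate in
theorem corollary5p5_general {A : Type u'} [Category.{v'} A] [Abelian A] [HasExt.{w} A]
    (V : ObjectProperty A) [V.ContainsZero] [V.IsClosedUnderBinaryProducts]
    [V.IsStableUnderRetracts] (hV : V ≤ leftPerp.{w} V) (M : A)
    (hM : injDim (gorenstein V) M < ⊤) :
    ∃ hT : HasTateCoresolution V M,
      List.TFAE [
        injDim V M < ⊤,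
        ∀ n : ℤ, ∀ (N : A) (hN : HasTateCoresolution V N), IsZero (tateExt V n M N hN),
        ∃ n : ℤ, ∀ (N : A) (hN : HasTateCoresolution V N), IsZero (tateExt V n M N hN),
        ∀ n : ℤ, ∀ N : A, IsZero (tateExt V n N M hT),
        ∃ n : ℤ, ∀ N : A, IsZero (tateExt V n N M hT),
        IsZero (tateExt V 0 M M hT)] := by
  have hT := hasTateCoresolution_of_injDim_gorenstein_lt_top hV hM
  let T := Classical.choice hT
  refine ⟨hT, ?_⟩
  simp only [isZero_tateExt_iff]
  tfae_have 1 → 2 := fun h n N hN => by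
    obtain ⟨d, hd⟩ := exists_finiteCoresolution_of_injDim_lt_top h
    exact (Classical.choice hN).totallyAcyclic.factorsThrough_of_finiteCoresolution hV d hd n
  tfae_have 2 → 3 := fun h => ⟨0, h 0⟩
  tfae_have 3 → 6 := fun ⟨n, h⟩ => by
    have hN := (T.totallyAcyclic.gorenstein_cycles (-n)).hasTateCoresolution
    have hS := T.totallyAcyclic.isStableRetract_cycles (Classical.choice hN) n
    rw [neg_add_cancel] at hS
    exact hS.factorsThrough (h _ hN)
  tfae_have 6 → 4 := fun h n N f => by
    simpa using (T.factorsThrough_id_of_factorsThrough h n).comp_left f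
  tfae_have 4 → 5 := fun h => ⟨0, h 0⟩
  tfae_have 5 → 1 := fun ⟨n, h⟩ => by
    obtain ⟨d, hd⟩ := T.finiteCoresolution_of_factorsThrough_id (h (T.S.cycles n) (𝟙 _))
    exact injDim_lt_top_of_finiteCoresolution hd
  tfae_finish

theorem corollary5p5 {R : Type u} [CommRing R] (C : ModuleCat.{u} R)
    (hC : RelativeTate.IsSemidualizing C) (M : ModuleCat.{u} R)
    (hM : RelativeTate.injDim (RelativeTate.gorenstein (RelativeTate.cInjective C)) M < ⊤) :
    ∃ hT : RelativeTate.HasTateCoresolution (RelativeTate.cInjective C) M,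
      List.TFAE [
        RelativeTate.injDim (RelativeTate.cInjective C) M < ⊤,
        ∀ n : ℤ, ∀ (N : ModuleCat.{u} R)
          (hN : RelativeTate.HasTateCoresolution (RelativeTate.cInjective C) N),
          IsZero (RelativeTate.tateExt (RelativeTate.cInjective C) n M N hN),
        ∃ n : ℤ, ∀ (N : ModuleCat.{u} R)
          (hN : RelativeTate.HasTateCoresolution (RelativeTate.cInjective C) N),
          IsZero (RelativeTate.tateExt (RelativeTate.cInjective C) n M N hN),
        ∀ n : ℤ, ∀ N : ModuleCat.{u} R,
          IsZero (RelativeTate.tateExt (RelativeTate.cInjective C) n N M hT),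
        ∃ n : ℤ, ∀ N : ModuleCat.{u} R,
          IsZero (RelativeTate.tateExt (RelativeTate.cInjective C) n N M hT),
        IsZero (RelativeTate.tateExt (RelativeTate.cInjective C) 0 M M hT)] := by
  have := hC.cInjective_isStableUnderRetracts
  exact corollary5p5_general _ hC.cInjective_le_leftPerp M hM
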